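/- **Setting.** Let $\mathbb D$ be the open unit disk, $\mathbb T$ the unit circle, $dm=d\theta/(2\pi)$ normalized Lebesgue measure on $\mathbb T$, and $P(t,a)=\frac{1-|a|^2}{|t-a|^2}$ ($t\in\mathbb T$, $a\in\mathbb D$) the Poisson kernel. Let $f$ be a Schur function (analytic on $\mathbb D$ with $|f|\le 1$) that is not a finite Blaschke product (unimodular constants count as Blaschke products of degree $0$), and let $(\alpha_k)_{k\ge 0}$ be a sequence of points of $\mathbb D$. The Schur remainders of $f$ are defined by $f_0=f$ and $$f_{k+1}=\frac{1}{\zeta_{k+1}}\,\frac{f_k-\gamma_k}{1-\overline{\gamma_k}f_k},\qquad \gamma_k=f_k(\alpha_{k+1}),\quad \zeta_{k+1}(z)=\frac{z-\alpha_{k+1}}{1-\overline{\alpha_{k+1}}z}\qquad (k\ge 0),$$ the removable singularity at $\alpha_{k+1}$ being removed; on $\mathbb T$, $f_k$ denotes the ($m$-a.e. defined) nontangential boundary function. Let $\mu$ be the Borel probability measure on $\mathbb T$ with $$\frac{1+zf(z)}{1-zf(z)}=\int_{\mathbb T}\frac{t+z}{t-z}\,d\mu(t)\qquad(z\in\mathbb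 D),$$ and write $d\mu=\mu'\,dm+d\mu_s$ with $\mu_s$ singular with respect to $m$, where $\mu'$ is a fixed everywhere-defined version of the density (the pointwise conditions below refer to this version). Let $A=\big(\overline{\{\alpha_k\}}\setminus\{\alpha_k\}\big)\cap\mathbb T$ be the set of accumulation points of $(\alpha_k)$ on $\mathbb T$. **Theorem.** Assume that $\sum_k(1-|\alpha_k|)=+\infty$, that $\lim_k|\alpha_k|=1$, and that $A\cap\operatorname{supp}\mu_s=\emptyset$, where $\operatorname{supp}$ is the closed support. 1. If there is an open set $O\subset\mathbb T$ containing $A$ on which $\mu'$ is continuous and strictly positive, then $$\lim_{k\to\infty}\int_{\mathbb T}|f_k|^2\,P(\cdot,\alpha_k)\,dm=0 .$$ 2. The same conclusion holds if, instead of the hypothesis of part 1, the sequence $(\alpha_k)$ accumulates nontangentially on $A$ and every $\xi\in A$ is a Lebesgue point of both $\mu'$ and $\sqrt{\mu'}$ with $\mu'(\xi)>0$. Here "accumulates nontangentially" means that for every subsequence of $(\alpha_k)$ converging to some $\xi\in\mathbb T$ there is $M>0$ such that its terms eventually lie in $\{z\in\mathbb D: |z-\xi|<M(1-|z|)\}$;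 and $\xi$ is a Lebesgue point of $w$ if the average of $|w-w(\xi)|$ over arcs centred at $\xi$ tends to $0$ as the arcs shrink to $\xi$. -/

import Mathlib

open MeasureTheory Filter Topology ComplexConjugate

noncomputable section

namespace MultipointSchur

instance circleMeasurableSpace : MeasurableSpace Circle := borel Circle

instance circleBorelSpace : BorelSpace Circle := ⟨rfl⟩

/-- Normalized Lebesgue measure `dθ / (2π)` on the unit circle. -/
def m : Measure Circle :=
  Measure.map Circle.exp
    ((ENNReal.ofReal (2 * Real.pi))⁻¹ • volume.restrict (Set.Ioc (-Real.pi) Real.pi))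

/-- The Schur class: analytic functions on the open unit disk bounded by one. Only the values
on the open unit disk matter. -/
def IsSchur (f : ℂ → ℂ) : Prop :=
  DifferentiableOn ℂ f (Metric.ball 0 1) ∧ ∀ z ∈ Metric.ball (0 : ℂ) 1, ‖f z‖ ≤ 1

/-- Finite Blaschke products, including the unimodular constants (degree zero). -/
def IsFiniteBlaschke (f : ℂ → ℂ) : Prop :=
  ∃ (n : ℕ) (β : Fin n → ℂ) (c : ℂ), (∀ j, ‖β j‖ < 1) ∧ ‖c‖ = 1 ∧
    ∀ z ∈ Metric.ball (0 : ℂ) 1, f z = c * ∏ j, (z - β j) / (1 - conj (β j) * z)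

/-- One step of the Schur algorithm at the point `a`: the analytic function equal to
`(1 / ζ) * (g - g a) / (1 - conj (g a) * g)`, where `ζ z = (z - a) / (1 - conj a * z)`.
The quotient `(g z - g a) / (z - a)` is written `dslope g a z`, whose value at `z = a` is `g' a`,
so that the removable singularity at `a` is removed. -/
def schurStep (a : ℂ) (g : ℂ → ℂ) : ℂ → ℂ := fun z =>
  (1 - conj a * z) * dslope g a z / (1 - conj (g a) * g z)

theorem schurStep_of_ne (a : ℂ) (g : ℂ → ℂ) (z : ℂ) (hz : z ≠ a) :
    schurStep a g z = (1 / ((z - a) / (1 - conj a * z))) *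
      ((g z - g a) / (1 - conj (g a) * g z)) := by
  simp only [schurStep, dslope_of_ne g hz, slope_def_field, one_div_div]
  ring

/-- The Schur remainders `f_k` of `f` with respect to the points `α 1, α 2, …`
(`α 0` plays no role). -/
def schurRemainder (α : ℕ → ℂ) (f : ℂ → ℂ) : ℕ → ℂ → ℂ
  | 0 => f
  | k + 1 => schurStep (α (k + 1)) (schurRemainder α f k)

/-- `μ` is the Herglotz measure of `f`:
`(1 + z f(z)) / (1 - z f(z)) = ∫ (t + z) / (t - z) dμ(t)` on the open unit disk. -/
def IsHerglotzMeasure (f : ℂ → ℂ) (μ : Measure Circle) : Prop :=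
  ∀ z ∈ Metric.ball (0 : ℂ) 1,
    (1 + z * f z) / (1 - z * f z) = ∫ t : Circle, ((t : ℂ) + z) / ((t : ℂ) - z) ∂μ

/-- The Poisson kernel `P(t, a)` for `t` on the circle and `a` in the disk. -/
def poisson (t : Circle) (a : ℂ) : ℝ := (1 - ‖a‖ ^ 2) / ‖(t : ℂ) - a‖ ^ 2

/-- The nontangential approach region with vertex `ξ` and aperture `M`. -/
def stolz (ξ : Circle) (M : ℝ) : Set ℂ := {z | ‖z‖ < 1 ∧ ‖z - ξ‖ < M * (1 - ‖z‖)}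

/-- The filter of nontangential approach to `ξ`: a function tends to `c` along it iff it tends
to `c` at `ξ` within every region `stolz ξ M`. -/
def nontangential (ξ : Circle) : Filter ℂ := ⨆ M : ℝ, 𝓝[stolz ξ M] (ξ : ℂ)

/-- The boundary function (trace on the circle) of `g`, given by nontangential limits. -/
def trace (g : ℂ → ℂ) (ξ : Circle) : ℂ := limUnder (nontangential ξ) g

/-- The points of the unit circle lying in `Acc(α) = closure {α k} \ {α k}`. -/
def accCircle (α : ℕ → ℂ) : Set Circle :=
  {ξ | (ξ : ℂ) ∈ closure (Set.range α) \ Set.range α}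

/-- Every subsequence of `α` converging to a point `ξ` of the unit circle
stays, eventually, in some nontangential approach region with vertex `ξ`. -/
def AccumulatesNontangentially (α : ℕ → ℂ) : Prop :=
  ∀ (ξ : Circle) (φ : ℕ → ℕ), StrictMono φ → Tendsto (α ∘ φ) atTop (𝓝 (ξ : ℂ)) →
    ∃ M : ℝ, ∀ᶠ k in atTop, α (φ k) ∈ stolz ξ M

/-- `ξ` is a Lebesgue point of `w`: the averages of `|w - w(ξ)|` over arcs centred at `ξ` and
shrinking to `ξ` tend to zero. -/
def IsLebesguePoint (w : Circle → ℝ) (ξ : Circle) : Prop :=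
  Tendsto (fun r : ℝ => ⨍ t in Metric.ball ξ r, |w t - w ξ| ∂m) (𝓝[>] 0) (𝓝 0)

/-- The integrand `|f_k|² P(·, α_k)` on the unit circle. -/
def remainderIntegrand (α : ℕ → ℂ) (f : ℂ → ℂ) (k : ℕ) (t : Circle) : ℝ :=
  ‖trace (schurRemainder α f k) t‖ ^ 2 * poisson t (α k)

end MultipointSchur

end

namespace MultipointSchur

/-! Fix `n = k + 1` and `b = α n`. Undoing `n` steps of the Schur algorithm writes `f` as a linear
fractional map of `f_n` (`wallMap`). On the circle this gives `Re ((1 + z f) / (1 - z f)) * ρ = (1 -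
|f_n|²) / |1 - g|²`, where `g = G f_n`, `G` is the inverse iterate (unimodular on the circle), and
`1 / ρ` is the density of the Wall approximant, obtained by replacing `f_n` with `0`
(`density_wallMap_mul_wallWeight`).

Three Poisson averages at `b` are then controlled. Since `G` contains the Blaschke factor of `b`, `g
b = 0` and `Re g` has average zero. The density `w` is at most the boundary value of the real part
of the Herglotz function (`ae_density_le`), so `w ρ` is dominated by `Re ((1 + g) / (1 - g))` and
has average at most `1`, by Fatou's lemma. The Wall approximant interpolates `f` at `b`, so `1 / ρ`
has the same average as `μ`.

If `α n` approaches `ξ` along a subsequence, the averages of `w`, `√w` and `μ` tend to `c`, `√c` and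
`c`, where `c = w ξ > 0`; for `μ` this uses that `ξ` lies off the support of the singular part. An
arithmetic–geometric mean inequality then forces `√(w ρ)` towards `1` in mean square. Since `w ρ |1
- g|² ≤ 1 - |g|²`, the function `|g|²` is at most `Re g` plus a small error on average, and `|g| =
|f_n|` almost everywhere on the circle. The quantitative form is `integral_remainderIntegrand_le`;
compactness (`tendsto_integral_remainderIntegrand`) reduces the theorem to such subsequences. -/

/-! ### Normalized arc length: size of balls and doubling. -/

lemma m_apply {s : Set Circle} (hs : MeasurableSet s) :
    m s = (ENNReal.ofReal (2 * Real.pi))⁻¹ *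
      volume (Circle.exp ⁻¹' s ∩ Set.Ioc (-Real.pi) Real.pi) := by
  have hc : Measurable (Circle.exp : ℝ → Circle) := Circle.exp.continuous.measurable
  rw [m, Measure.map_apply hc hs, Measure.smul_apply, Measure.restrict_apply (hc hs), smul_eq_mul]

instance : IsProbabilityMeasure m := ⟨by
  have hpi := Real.pi_pos
  rw [m_apply MeasurableSet.univ, Set.preimage_univ, Set.univ_inter, Real.volume_Ioc,
    show Real.pi - -Real.pi = 2 * Real.pi by ring]
  exact ENNReal.inv_mul_cancel (by simpa using hpi) ENNReal.ofReal_ne_top⟩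

lemma integral_m {E : Type*} [NormedAddCommGroup E] [NormedSpace ℝ E] {g : Circle → E}
    (hg : AEStronglyMeasurable g m) :
    ∫ t, g t ∂m = (2 * Real.pi)⁻¹ • ∫ θ in Set.Ioc (-Real.pi) Real.pi, g (Circle.exp θ) := by
  have hc : Measurable (Circle.exp : ℝ → Circle) := Circle.exp.continuous.measurable
  unfold m at hg ⊢
  rw [integral_map hc.aemeasurable hg, integral_smul_measure, ENNReal.toReal_inv,
    ENNReal.toReal_ofReal (by positivity)]

lemma dist_circle_exp (θ φ : ℝ) :
    dist (Circle.exp θ) (Circle.exp φ) = 2 * |Real.sin ((θ - φ) / 2)| := by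
  have h : dist (Circle.exp θ) (Circle.exp φ) =
      ‖Complex.exp (θ * Complex.I) - Complex.exp (φ * Complex.I)‖ := by
    rw [← Circle.coe_exp, ← Circle.coe_exp, ← dist_eq_norm]
    rfl
  rw [h, show Complex.exp (θ * Complex.I) - Complex.exp (φ * Complex.I) =
    Complex.exp (φ * Complex.I) * (Complex.exp (Complex.I * (θ - φ : ℝ)) - 1) by
      rw [mul_sub, ← Complex.exp_add, mul_one]; congr 2; push_cast; ring]
  rw [norm_mul, Complex.norm_exp_ofReal_mul_I, one_mul, Complex.norm_exp_I_mul_ofReal_sub_one,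
    Real.norm_eq_abs, abs_mul, abs_two]

lemma exists_exp_eq (ξ : Circle) : ∃ φ ∈ Set.Ioc (-Real.pi) Real.pi, Circle.exp φ = ξ :=
  ⟨Complex.arg ξ, Complex.arg_mem_Ioc _, Circle.exp_arg ξ⟩

/-- The metric is chordal, and Jordan's inequality bounds an arc by `π / 2` times its chord. Three
intervals are needed because an arc may wrap around an end of `(-π, π]`; they give `3r / 2`, rounded
up to `2r`. -/
lemma m_closedBall_le (ξ : Circle) {r : ℝ} (hr : 0 ≤ r) :
    m (Metric.closedBall ξ r) ≤ ENNReal.ofReal (2 * r) := by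
  have hpi := Real.pi_pos
  obtain ⟨φ, hφ, rfl⟩ := exists_exp_eq ξ
  have hsub : Circle.exp ⁻¹' (Metric.closedBall (Circle.exp φ) r) ∩ Set.Ioc (-Real.pi) Real.pi ⊆
      Metric.closedBall φ (Real.pi * r / 2) ∪ (Metric.closedBall (φ + 2 * Real.pi) (Real.pi * r / 2)
        ∪ Metric.closedBall (φ - 2 * Real.pi) (Real.pi * r / 2)) := by
    rintro θ ⟨h1, h2⟩
    rw [Set.mem_preimage, Metric.mem_closedBall, dist_circle_exp] at h1
    obtain ⟨h1a, h1b⟩ := abs_le.1 (show |Real.sin ((θ - φ) / 2)| ≤ r / 2 by linarith)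
    obtain ⟨ha, hb⟩ := hφ
    obtain ⟨hc, hd⟩ := h2
    have key : ∀ y : ℝ, 0 ≤ y → y < Real.pi → Real.sin y ≤ r / 2 →
        2 * y ≤ Real.pi * r / 2 ∨ 2 * Real.pi - 2 * y ≤ Real.pi * r / 2 := by
      intro y hy0 hy1 hs
      rcases le_total y (Real.pi / 2) with h | h
      · left
        have := Real.mul_le_sin hy0 h
        have : 2 / Real.pi * y ≤ r / 2 := this.trans hs
        rw [div_mul_eq_mul_div, div_le_iff₀ hpi] at this
        linarith
      · right
        have := Real.mul_le_sin (x := Real.pi - y) (by linarith) (by linarith)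
        rw [Real.sin_pi_sub] at this
        have : 2 / Real.pi * (Real.pi - y) ≤ r / 2 := this.trans hs
        rw [div_mul_eq_mul_div, div_le_iff₀ hpi] at this
        linarith
    simp only [Set.mem_union, Metric.mem_closedBall, Real.dist_eq, abs_le]
    rcases le_total φ θ with h | h
    · rcases key ((θ - φ) / 2) (by linarith) (by linarith) h1b with h | h
      · left; constructor <;> linarith
      · right; left; constructor <;> linarith
    · rcases key ((φ - θ) / 2) (by linarith) (by linarith) (by
        rw [show (φ - θ) / 2 = -((θ - φ) / 2) by ring, Real.sin_neg]; linarith) with h | h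
      · left; constructor <;> linarith
      · right; right; constructor <;> linarith
  rw [m_apply measurableSet_closedBall]
  calc _ ≤ (ENNReal.ofReal (2 * Real.pi))⁻¹ * (ENNReal.ofReal (Real.pi * r) +
        (ENNReal.ofReal (Real.pi * r) + ENNReal.ofReal (Real.pi * r))) := by
        gcongr
        refine (measure_mono hsub).trans ((measure_union_le _ _).trans ?_)
        refine add_le_add ?_ ((measure_union_le _ _).trans (add_le_add ?_ ?_)) <;>
        · rw [Real.volume_closedBall]
          exact (congrArg _ (by ring)).le
    _ ≤ _ := by
        rw [← ENNReal.ofReal_add (by positivity) (by positivity),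
          ← ENNReal.ofReal_add (by positivity) (by positivity),
          ← ENNReal.ofReal_inv_of_pos (by positivity), ← ENNReal.ofReal_mul (by positivity)]
        apply ENNReal.ofReal_le_ofReal
        field_simp
        linarith

/-- A one-sided interval of length `r`, on the side of the centre facing `0`, never leaves `(-π,
π]`, so no wrapping occurs. -/
lemma le_m_ball (ξ : Circle) {r : ℝ} (hr1 : r ≤ 1) :
    ENNReal.ofReal (r / (2 * Real.pi)) ≤ m (Metric.ball ξ r) := by
  have hpi := Real.pi_gt_three
  obtain ⟨φ, hφ, rfl⟩ := exists_exp_eq ξ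
  obtain ⟨ha, hb⟩ := hφ
  have hd : ∀ θ, |θ - φ| < r → dist (Circle.exp θ) (Circle.exp φ) < r := fun θ h => by
    rw [dist_circle_exp]
    have := Real.abs_sin_le_abs (x := (θ - φ) / 2)
    rw [abs_div, abs_two] at this
    linarith
  have hvol : ENNReal.ofReal r ≤
      volume (Circle.exp ⁻¹' (Metric.ball (Circle.exp φ) r) ∩ Set.Ioc (-Real.pi) Real.pi) := by
    rcases le_total φ 0 with h | h
    · have : Set.Ioo φ (φ + r) ⊆
          Circle.exp ⁻¹' (Metric.ball (Circle.exp φ) r) ∩ Set.Ioc (-Real.pi) Real.pi := by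
        rintro θ ⟨h1, h2⟩
        exact ⟨hd θ (abs_lt.2 ⟨by linarith, by linarith⟩), by linarith, by linarith⟩
      refine le_trans (by rw [Real.volume_Ioo]; simp) (measure_mono this)
    · have : Set.Ioo (φ - r) φ ⊆
          Circle.exp ⁻¹' (Metric.ball (Circle.exp φ) r) ∩ Set.Ioc (-Real.pi) Real.pi := by
        rintro θ ⟨h1, h2⟩
        exact ⟨hd θ (abs_lt.2 ⟨by linarith, by linarith⟩), by linarith, by linarith⟩
      refine le_trans (by rw [Real.volume_Ioo]; simp) (measure_mono this)
  rw [m_apply measurableSet_ball]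
  refine le_trans ?_ (mul_le_mul_right hvol _)
  rw [← ENNReal.ofReal_inv_of_pos (by positivity), ← ENNReal.ofReal_mul (by positivity)]
  exact (congrArg _ (by ring)).le

/-- Needed for the Lebesgue differentiation theorem. The constant is the ratio of `2 * (2r)` to `r /
(2π)`. -/
instance : IsUnifLocDoublingMeasure m := ⟨⟨(8 * Real.pi).toNNReal, by
  filter_upwards [Ioo_mem_nhdsGT (zero_lt_one (α := ℝ))] with r hr x
  obtain ⟨h0, h1⟩ := hr
  have hpi := Real.pi_pos
  refine (m_closedBall_le x (by linarith)).trans ?_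
  refine le_trans ?_ (mul_le_mul_right ((le_m_ball x h1.le).trans
    (measure_mono Metric.ball_subset_closedBall)) _)
  rw [← ENNReal.ofReal, ← ENNReal.ofReal_mul (by positivity)]
  apply ENNReal.ofReal_le_ofReal
  field_simp
  norm_num⟩⟩

/-! ### The Poisson kernel and the Poisson formula. -/

lemma circle_sub_ne_zero {a : ℂ} (ha : ‖a‖ < 1) (t : Circle) : (t : ℂ) - a ≠ 0 := by
  intro h
  rw [← sub_eq_zero.1 h, Circle.norm_coe] at ha
  exact lt_irrefl _ ha

lemma continuous_poisson {a : ℂ} (ha : ‖a‖ < 1) : Continuous fun t => poisson t a := by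
  unfold poisson
  refine continuous_const.div (by fun_prop) fun t => ?_
  have := circle_sub_ne_zero ha t
  positivity

lemma poisson_nonneg {a : ℂ} (ha : ‖a‖ < 1) (t : Circle) : 0 ≤ poisson t a := by
  have : 0 ≤ 1 - ‖a‖ ^ 2 := by nlinarith [norm_nonneg a]
  unfold poisson; positivity

lemma poisson_eq_re {a : ℂ} (t : Circle) :
    poisson t a = (((t : ℂ) + a) / ((t : ℂ) - a)).re := by
  have := congrFun (poissonKernel_eq_re_herglotzRieszKernel (c := 0) (w := a)) t
  simpa [poissonKernel_def, herglotzRieszKernel_def, poisson, Circle.norm_coe] using this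

/-- The Poisson integral formula on the unit circle. -/
theorem integral_poisson_smul {h : ℂ → ℂ} (hh : DiffContOnCl ℂ h (Metric.ball 0 1)) {a : ℂ}
    (ha : ‖a‖ < 1) : ∫ t : Circle, poisson t a • h t ∂m = h a := by
  have hcont : Continuous fun t : Circle => poisson t a • h t := by
    refine (continuous_poisson ha).smul ?_
    refine hh.continuousOn.comp_continuous (by fun_prop) fun t => ?_
    rw [closure_ball _ one_ne_zero]; simp [Circle.norm_coe]
  rw [integral_m hcont.aestronglyMeasurable]
  have key := hh.circleAverage_poissonKernel_smul (w := a) (by simpa using ha)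
  rw [Real.circleAverage_eq_integral_add (-Real.pi)] at key
  rw [← key, ← intervalIntegral.integral_of_le (by linarith [Real.pi_pos])]
  congr 1
  rw [intervalIntegral.integral_comp_add_right (fun θ =>
    (poissonKernel 0 a • h) (circleMap 0 1 θ))]
  rw [show (0 : ℝ) + -Real.pi = -Real.pi by ring, show 2 * Real.pi + -Real.pi = Real.pi by ring]
  refine intervalIntegral.integral_congr fun θ _ => ?_
  simp [poissonKernel_def, poisson, circleMap]

lemma integral_poisson {a : ℂ} (ha : ‖a‖ < 1) : ∫ t : Circle, poisson t a ∂m = 1 := by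
  have := integral_poisson_smul (h := fun _ => 1) diffContOnCl_const ha
  simp only [Complex.real_smul, mul_one] at this
  rw [integral_complex_ofReal] at this
  exact_mod_cast this

lemma integrable_of_continuous {E : Type*} [NormedAddCommGroup E] {h : Circle → E}
    (hh : Continuous h) (ν : Measure Circle) [IsFiniteMeasure ν] : Integrable h ν :=
  hh.integrable_of_hasCompactSupport (HasCompactSupport.of_compactSpace h)

lemma integrable_mul_poisson {u : Circle → ℝ} {ν : Measure Circle} (hu : Integrable u ν) {a : ℂ}
    (ha : ‖a‖ < 1) : Integrable (fun t => u t * poisson t a) ν := by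
  obtain ⟨C, hC⟩ := (isCompact_univ (X := Circle)).exists_bound_of_continuousOn
    (continuous_poisson ha).continuousOn
  exact hu.mul_bdd (c := C) (continuous_poisson ha).aestronglyMeasurable
    (Eventually.of_forall fun t => hC t trivial)


/-! ### Nontangential limits of Poisson integrals at Lebesgue points. -/

/-- The least `k ≤ N` with `d < 2 ^ k * δ` already supplies a large enough term, since `d ≥ 2 ^ (k -
1) * δ` when `k > 0`. If there is no such `k`, the last summand suffices. This turns the kernel into
a combination of indicators of balls. -/
lemma kernel_le_dyadic_sum {δ d : ℝ} (hδ : 0 < δ) (N : ℕ) :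
    δ / max δ d ^ 2 ≤ ∑ k ∈ Finset.range (N + 1),
      (4 / (4 ^ k * δ) * if d < 2 ^ k * δ then 1 else 0) + 1 / (4 ^ N * δ) := by
  have hpos : ∀ k ∈ Finset.range (N + 1), 0 ≤ 4 / (4 ^ k * δ) * if d < 2 ^ k * δ then (1 : ℝ) else 0 := by
    intro k _
    split_ifs <;> positivity
  have hsq : ∀ k : ℕ, 2 ^ k * δ ≤ d → δ / max δ d ^ 2 ≤ 1 / (4 ^ k * δ) := by
    intro k hk
    have h1 : (2 ^ k * δ) ^ 2 ≤ max δ d ^ 2 := by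
      gcongr
      exact hk.trans (le_max_right _ _)
    calc δ / max δ d ^ 2 ≤ δ / (2 ^ k * δ) ^ 2 := by gcongr
      _ = 1 / (4 ^ k * δ) := by
        rw [mul_pow, ← pow_mul, mul_comm k 2, pow_mul]; norm_num; field_simp
  by_cases h : ∃ k, k ≤ N ∧ d < 2 ^ k * δ
  · classical
    have hk := Nat.find_spec h
    have hmin := fun m hm => Nat.find_min h (m := m) hm
    generalize Nat.find h = k at hk hmin
    have hsum := Finset.single_le_sum hpos (Finset.mem_range.2 (Nat.lt_succ_of_le hk.1))
    rw [if_pos hk.2, mul_one] at hsum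
    have : δ / max δ d ^ 2 ≤ 4 / (4 ^ k * δ) := by
      rcases k with _ | k
      · have h1 : δ ^ 2 ≤ max δ d ^ 2 := by gcongr; exact le_max_left _ _
        calc δ / max δ d ^ 2 ≤ δ / δ ^ 2 := by gcongr
          _ = 1 / (4 ^ 0 * δ) := by field_simp
          _ ≤ _ := by gcongr; norm_num
      · have h1 := hmin k (Nat.lt_succ_self k)
        push Not at h1
        refine (hsq k (h1 (by omega))).trans (le_of_eq ?_)
        rw [pow_succ]; field_simp
    have : 0 ≤ 1 / (4 ^ N * δ) := by positivity
    linarith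
  · push Not at h
    exact (hsq N (h N le_rfl)).trans (le_add_of_nonneg_left (Finset.sum_nonneg hpos))

lemma integrable_mul_kernel {u : Circle → ℝ} (hi : Integrable u m) (ξ : Circle) {δ : ℝ}
    (hδ : 0 < δ) : Integrable (fun t => u t * (δ / max δ (dist t ξ) ^ 2)) m := by
  have hc : Continuous fun t : Circle => δ / max δ (dist t ξ) ^ 2 := by
    refine continuous_const.div (by fun_prop) fun t => ?_
    have : 0 < max δ (dist t ξ) := lt_max_of_lt_left hδ
    positivity
  obtain ⟨C, hC⟩ := (isCompact_univ (X := Circle)).exists_bound_of_continuousOn hc.continuousOn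
  exact hi.mul_bdd (c := C) hc.aestronglyMeasurable (Eventually.of_forall fun t => hC t trivial)

lemma tendsto_integral_kernel {u : Circle → ℝ} (hu : ∀ t, 0 ≤ u t) (hi : Integrable u m)
    {ξ : Circle} (h : Tendsto (fun r : ℝ => (∫ t in Metric.ball ξ r, u t ∂m) / r) (𝓝[>] 0) (𝓝 0)) :
    Tendsto (fun δ : ℝ => ∫ t, u t * (δ / max δ (dist t ξ) ^ 2) ∂m) (𝓝[>] 0) (𝓝 0) := by
  rw [Metric.tendsto_nhds]
  intro ε hε
  have h1 : ∀ᶠ r in 𝓝[>] (0 : ℝ), ∫ t in Metric.ball ξ r, u t ∂m ≤ ε / 16 * r := by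
    filter_upwards [(Metric.tendsto_nhds.1 h) (ε / 16) (by positivity), self_mem_nhdsWithin]
      with r hr hr0
    rw [Real.dist_eq, sub_zero] at hr
    exact (div_le_iff₀ hr0).1 (le_abs_self _ |>.trans hr.le)
  obtain ⟨s, hs0, hs⟩ := mem_nhdsGT_iff_exists_Ioc_subset.1 h1
  simp only [Set.mem_Ioi] at hs0
  have hs' : ∀ r, 0 < r → r ≤ s → ∫ t in Metric.ball ξ r, u t ∂m ≤ ε / 16 * r :=
    fun r h0 h1 => hs ⟨h0, h1⟩
  set I := ∫ t, u t ∂m with hI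
  have hI0 : 0 ≤ I := integral_nonneg hu
  have hlim : Tendsto (fun δ : ℝ => 4 * δ / s ^ 2 * I) (𝓝[>] 0) (𝓝 0) := by
    have : Tendsto (fun δ : ℝ => 4 * δ / s ^ 2 * I) (𝓝 0) (𝓝 (4 * 0 / s ^ 2 * I)) :=
      Continuous.tendsto (by fun_prop) 0
    simpa using this.mono_left nhdsWithin_le_nhds
  filter_upwards [self_mem_nhdsWithin, Ioo_mem_nhdsGT hs0,
    hlim.eventually (gt_mem_nhds (half_pos hε))] with δ hδ0 hδs hδ
  have hδ0 : 0 < δ := hδ0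
  -- The dyadic scales stop at the last one where the density bound is known. The `k`-th ball then
  -- contributes `ε / 4 * (1 / 2) ^ k`, and the far part is `O(δ / s²)`.
  obtain ⟨N, hN1, hN2⟩ : ∃ N : ℕ, 2 ^ N * δ ≤ s ∧ s < 2 ^ (N + 1) * δ := by
    obtain ⟨N, hN1, hN2⟩ := exists_nat_pow_near (x := s / δ) (y := 2)
      ((one_le_div hδ0).2 hδs.2.le) (by norm_num)
    exact ⟨N, (le_div_iff₀ hδ0).1 hN1, (div_lt_iff₀ hδ0).1 hN2⟩
  have hint : ∀ k : ℕ, Integrable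
      (fun t => 4 / (4 ^ k * δ) * (Metric.ball ξ (2 ^ k * δ)).indicator u t) m := fun k =>
    (hi.indicator measurableSet_ball).const_mul _
  have hbound : ∫ t, u t * (δ / max δ (dist t ξ) ^ 2) ∂m ≤
      ∑ k ∈ Finset.range (N + 1), 4 / (4 ^ k * δ) * (ε / 16 * (2 ^ k * δ)) +
        1 / (4 ^ N * δ) * I := by
    calc _ ≤ ∫ t, (∑ k ∈ Finset.range (N + 1), (4 / (4 ^ k * δ) *
          (Metric.ball ξ (2 ^ k * δ)).indicator u t) + 1 / (4 ^ N * δ) * u t) ∂m := by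
          refine integral_mono (integrable_mul_kernel hi ξ hδ0)
            ((integrable_finsetSum _ fun k _ => hint k).add (hi.const_mul _)) fun t => ?_
          refine (mul_le_mul_of_nonneg_left (kernel_le_dyadic_sum hδ0 N) (hu t)).trans
            (le_of_eq ?_)
          rw [mul_add, Finset.mul_sum, mul_comm (u t) (1 / _)]
          congr 1
          refine Finset.sum_congr rfl fun k _ => ?_
          simp only [Set.indicator, Metric.mem_ball]
          split_ifs <;> ring
      _ = ∑ k ∈ Finset.range (N + 1), 4 / (4 ^ k * δ) *
            (∫ t in Metric.ball ξ (2 ^ k * δ), u t ∂m) + 1 / (4 ^ N * δ) * I := by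
          rw [integral_add (integrable_finsetSum _ fun k _ => hint k) (hi.const_mul _),
            integral_finsetSum _ fun k _ => hint k, integral_const_mul]
          congr 1
          refine Finset.sum_congr rfl fun k _ => ?_
          rw [integral_const_mul, integral_indicator measurableSet_ball]
      _ ≤ _ := by
          gcongr with k hk
          refine hs' _ (by positivity) (le_trans ?_ hN1)
          gcongr
          · norm_num
          · exact Nat.lt_succ_iff.1 (Finset.mem_range.1 hk)
  have hsum : ∑ k ∈ Finset.range (N + 1), 4 / (4 ^ k * δ) * (ε / 16 * (2 ^ k * δ)) ≤ ε / 2 := by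
    have : ∀ k : ℕ, 4 / (4 ^ k * δ) * (ε / 16 * (2 ^ k * δ)) = ε / 4 * (1 / 2) ^ k := by
      intro k
      rw [show (4 : ℝ) = 2 * 2 by norm_num, mul_pow, one_div, inv_pow]
      field_simp
      norm_num
    simp_rw [this]
    rw [← Finset.mul_sum]
    have := sum_geometric_two_le (N + 1)
    nlinarith
  have hlast : 1 / (4 ^ N * δ) * I ≤ 4 * δ / s ^ 2 * I := by
    gcongr ?_ * I
    rw [div_le_div_iff₀ (by positivity) (by positivity), one_mul]
    have : s ^ 2 ≤ (2 ^ (N + 1) * δ) ^ 2 := by gcongr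
    refine this.trans (le_of_eq ?_)
    rw [mul_pow, ← pow_mul, mul_comm (N + 1) 2, pow_mul, show (2 : ℝ) ^ 2 = 4 by norm_num, pow_succ]
    ring
  have h0 : 0 ≤ ∫ t, u t * (δ / max δ (dist t ξ) ^ 2) ∂m :=
    integral_nonneg fun t => mul_nonneg (hu t) (by positivity)
  rw [Real.dist_eq, sub_zero, abs_of_nonneg h0]
  linarith

lemma one_sub_norm_le_dist {z : ℂ} (t : Circle) : 1 - ‖z‖ ≤ ‖(t : ℂ) - z‖ := by
  have := norm_sub_norm_le (t : ℂ) z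
  rwa [Circle.norm_coe] at this

/-- In a Stolz region `|t - z|` dominates both `1 - |z|` and, up to the factor `1 + M`, the distance
from `t` to the vertex. The factor `2` comes from `1 - |z|² ≤ 2 (1 - |z|)`. -/
lemma poisson_le_of_mem_stolz {ξ : Circle} {M : ℝ} {z : ℂ} (hz : z ∈ stolz ξ M) (t : Circle) :
    poisson t z ≤ 2 * (1 + M) ^ 2 * ((1 - ‖z‖) / max (1 - ‖z‖) (dist t ξ) ^ 2) := by
  obtain ⟨hz1, hz2⟩ := hz
  have hδ : 0 < 1 - ‖z‖ := by linarith
  have hM : 0 < M := by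
    by_contra h
    nlinarith [norm_nonneg (z - ξ)]
  have h1 := one_sub_norm_le_dist (z := z) t
  have h2 : dist t ξ ≤ ‖(t : ℂ) - z‖ + ‖z - ξ‖ := by
    have : dist t ξ = ‖(t : ℂ) - ξ‖ := by rw [← dist_eq_norm]; rfl
    rw [this]
    exact norm_sub_le_norm_sub_add_norm_sub _ _ _
  have h3 : max (1 - ‖z‖) (dist t ξ) ≤ (1 + M) * ‖(t : ℂ) - z‖ :=
    max_le (by nlinarith) (by nlinarith)
  have h4 : 0 < max (1 - ‖z‖) (dist t ξ) := lt_max_of_lt_left hδ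
  have h5 : 0 < ‖(t : ℂ) - z‖ := by linarith
  have h6 : max (1 - ‖z‖) (dist t ξ) ^ 2 ≤ ((1 + M) * ‖(t : ℂ) - z‖) ^ 2 := by gcongr
  unfold poisson
  rw [← mul_div_assoc, div_le_div_iff₀ (by positivity) (by positivity)]
  calc (1 - ‖z‖ ^ 2) * max (1 - ‖z‖) (dist t ξ) ^ 2
      ≤ (2 * (1 - ‖z‖)) * ((1 + M) * ‖(t : ℂ) - z‖) ^ 2 := by
        gcongr
        nlinarith [norm_nonneg z]
    _ = _ := by ring

/-- Poisson averages of a function with vanishing mean density at `ξ` tend to zero when `ξ` is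
approached nontangentially. -/
theorem tendsto_integral_mul_poisson_stolz {u : Circle → ℝ} (hu : ∀ t, 0 ≤ u t)
    (hi : Integrable u m) {ξ : Circle}
    (h : Tendsto (fun r : ℝ => (∫ t in Metric.ball ξ r, u t ∂m) / r) (𝓝[>] 0) (𝓝 0)) (M : ℝ) :
    Tendsto (fun z => ∫ t, u t * poisson t z ∂m) (𝓝[stolz ξ M] (ξ : ℂ)) (𝓝 0) := by
  have hnorm : Tendsto (fun z : ℂ => 1 - ‖z‖) (𝓝[stolz ξ M] (ξ : ℂ)) (𝓝[>] 0) := by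
    refine tendsto_nhdsWithin_iff.2 ⟨?_, ?_⟩
    · have : Tendsto (fun z : ℂ => 1 - ‖z‖) (𝓝 (ξ : ℂ)) (𝓝 (1 - ‖(ξ : ℂ)‖)) :=
        Continuous.tendsto (by fun_prop) _
      rw [Circle.norm_coe, sub_self] at this
      exact this.mono_left nhdsWithin_le_nhds
    · filter_upwards [self_mem_nhdsWithin] with z hz
      exact sub_pos.2 hz.1
  have hlim := ((tendsto_integral_kernel hu hi h).comp hnorm).const_mul (2 * (1 + M) ^ 2)
  rw [mul_zero] at hlim
  refine squeeze_zero' ?_ ?_ hlim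
  · filter_upwards [self_mem_nhdsWithin] with z hz
    exact integral_nonneg fun t => mul_nonneg (hu t) (poisson_nonneg hz.1 t)
  · filter_upwards [self_mem_nhdsWithin] with z hz
    rw [Function.comp_apply, ← integral_const_mul]
    refine integral_mono (integrable_mul_poisson hi hz.1)
      ((integrable_mul_kernel hi ξ (sub_pos.2 hz.1)).const_mul _) fun t => ?_
    calc u t * poisson t z ≤ u t * _ :=
          mul_le_mul_of_nonneg_left (poisson_le_of_mem_stolz hz t) (hu t)
      _ = _ := by ring

/-- The sets `s r` are left free because the definition of a Lebesgue point averages over open balls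
while the differentiation theorem averages over closed ones. -/
lemma tendsto_integral_ball_div {u : Circle → ℝ} (hu : ∀ t, 0 ≤ u t) {ξ : Circle}
    {s : ℝ → Set Circle} (hi : Integrable u m)
    (hs : ∀ r, Metric.ball ξ r ⊆ s r) (hs' : ∀ r, s r ⊆ Metric.closedBall ξ r)
    (h : Tendsto (fun r : ℝ => ⨍ t in s r, u t ∂m) (𝓝[>] 0) (𝓝 0)) :
    Tendsto (fun r : ℝ => (∫ t in Metric.ball ξ r, u t ∂m) / r) (𝓝[>] 0) (𝓝 0) := by
  have h2 := h.const_mul 2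
  rw [mul_zero] at h2
  refine squeeze_zero' ?_ ?_ h2
  · filter_upwards [self_mem_nhdsWithin] with r hr
    exact div_nonneg (integral_nonneg hu) (le_of_lt hr)
  · filter_upwards [self_mem_nhdsWithin] with r hr
    have hr : 0 < r := hr
    have h3 : ∫ t in Metric.ball ξ r, u t ∂m ≤ ∫ t in s r, u t ∂m :=
      setIntegral_mono_set hi.integrableOn (Eventually.of_forall hu) (hs r).eventuallyLE
    have h4 : m.real (s r) • ⨍ t in s r, u t ∂m = ∫ t in s r, u t ∂m :=
      measure_smul_setAverage _ (measure_ne_top _ _)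
    have h5 : m.real (s r) ≤ 2 * r :=
      ENNReal.toReal_le_of_le_ofReal (by positivity)
        ((measure_mono (hs' r)).trans (m_closedBall_le ξ hr.le))
    have h6 : 0 ≤ ⨍ t in s r, u t ∂m := by
      rw [setAverage_eq]
      exact smul_nonneg (by positivity) (integral_nonneg hu)
    rw [div_le_iff₀ hr]
    rw [smul_eq_mul] at h4
    nlinarith

lemma IsLebesguePoint.tendsto_integral_ball_div {w : Circle → ℝ} {ξ : Circle}
    (h : IsLebesguePoint w ξ) (hw : Integrable w m) :
    Tendsto (fun r : ℝ => (∫ t in Metric.ball ξ r, |w t - w ξ| ∂m) / r) (𝓝[>] 0) (𝓝 0) :=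
  MultipointSchur.tendsto_integral_ball_div (fun _ => abs_nonneg _)
    (hw.sub (integrable_const _)).abs (fun _ => subset_rfl)
    (fun _ => Metric.ball_subset_closedBall) h

/-- Almost every point is a Lebesgue point. -/
lemma ae_tendsto_integral_ball_div {E : Type*} [NormedAddCommGroup E] {u : Circle → E}
    (hu : Integrable u m) : ∀ᵐ ξ ∂m,
      Tendsto (fun r : ℝ => (∫ t in Metric.ball ξ r, ‖u t - u ξ‖ ∂m) / r) (𝓝[>] 0) (𝓝 0) := by
  filter_upwards [IsUnifLocDoublingMeasure.ae_tendsto_average_norm_sub m hu.locallyIntegrable 1]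
    with ξ hξ
  refine MultipointSchur.tendsto_integral_ball_div (fun _ => norm_nonneg _)
    (hu.sub (integrable_const _)).norm
    (fun _ => Metric.ball_subset_closedBall) (fun _ => subset_rfl)
    (hξ (fun _ => ξ) id tendsto_id ?_)
  filter_upwards [self_mem_nhdsWithin] with r hr
  have : (0 : ℝ) ≤ r := le_of_lt hr
  simpa using this


/-! ### Fatou's theorem and boundary values of Schur functions. -/

/-- A sequence of radii increasing to one. -/
noncomputable def radius (j : ℕ) : ℝ := 1 - 1 / ((j : ℝ) + 1 + 1)

lemma radius_pos (j : ℕ) : 0 < radius j := by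
  have : 1 / ((j : ℝ) + 1 + 1) < 1 := by
    rw [div_lt_one (by positivity)]
    have : (0 : ℝ) ≤ j := by positivity
    linarith
  unfold radius; linarith

lemma radius_lt_one (j : ℕ) : radius j < 1 := by
  have : 0 < 1 / ((j : ℝ) + 1 + 1) := by positivity
  unfold radius; linarith

lemma tendsto_radius : Tendsto radius atTop (𝓝 1) := by
  have := (tendsto_const_nhds (x := (1 : ℝ))).sub
    ((tendsto_add_atTop_iff_nat 1).2 (tendsto_one_div_add_atTop_nhds_zero_nat (𝕜 := ℝ)))
  rw [sub_zero] at this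
  refine this.congr fun j => ?_
  simp [radius]

lemma norm_radius_mul_lt (j : ℕ) {z : ℂ} (hz : ‖z‖ ≤ 1) : ‖(radius j : ℂ) * z‖ < 1 := by
  rw [norm_mul, Complex.norm_real, Real.norm_of_nonneg (radius_pos j).le]
  nlinarith [radius_pos j, radius_lt_one j, norm_nonneg z]

lemma tendsto_radius_mul (z : ℂ) : Tendsto (fun j => (radius j : ℂ) * z) atTop (𝓝 z) := by
  have := ((Complex.continuous_ofReal.tendsto 1).comp tendsto_radius).mul_const z
  simpa using this

lemma tendsto_radius_nontangential (ξ : Circle) :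
    Tendsto (fun j => (radius j : ℂ) * ξ) atTop (nontangential ξ) := by
  -- On the radius `|z - ξ| = 1 - |z|`, so any aperture above `1` works.
  refine Tendsto.mono_right ?_ (le_iSup (fun M : ℝ => 𝓝[stolz ξ M] (ξ : ℂ)) 2)
  refine tendsto_nhdsWithin_iff.2 ⟨tendsto_radius_mul _, Eventually.of_forall fun j => ?_⟩
  refine ⟨norm_radius_mul_lt j (Circle.norm_coe ξ).le, ?_⟩
  have h1 : ‖(radius j : ℂ) * ξ - ξ‖ = 1 - radius j := by
    rw [show (radius j : ℂ) * ξ - ξ = ((radius j - 1 : ℝ) : ℂ) * ξ by push_cast; ring, norm_mul,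
      Circle.norm_coe, mul_one, Complex.norm_real, Real.norm_eq_abs, abs_sub_comm,
      abs_of_pos (sub_pos.2 (radius_lt_one j))]
  rw [h1, norm_mul, Circle.norm_coe, mul_one, Complex.norm_real,
    Real.norm_of_nonneg (radius_pos j).le]
  linarith [radius_lt_one j]

instance (ξ : Circle) : (nontangential ξ).NeBot := (tendsto_radius_nontangential ξ).neBot

lemma diffContOnCl_comp_radius {h : ℂ → ℂ} (hh : DifferentiableOn ℂ h (Metric.ball 0 1)) (j : ℕ) :
    DiffContOnCl ℂ (fun z => h (radius j * z)) (Metric.ball 0 1) := by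
  refine DifferentiableOn.diffContOnCl ?_
  rw [closure_ball _ one_ne_zero]
  refine hh.comp (by fun_prop) fun z hz => ?_
  rw [mem_ball_zero_iff]
  exact norm_radius_mul_lt j (by simpa using hz)

lemma continuous_comp_radius {h : ℂ → ℂ} (hh : DifferentiableOn ℂ h (Metric.ball 0 1)) (j : ℕ) :
    Continuous fun t : Circle => h (radius j * t) := by
  refine hh.continuousOn.comp_continuous (by fun_prop) fun t => ?_
  rw [mem_ball_zero_iff]
  exact norm_radius_mul_lt j (Circle.norm_coe t).le

/-- A Schur function is the Poisson integral of a square integrable function. -/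
lemma IsSchur.exists_poisson {g : ℂ → ℂ} (hg : IsSchur g) :
    ∃ b : Circle → ℂ, Integrable b m ∧
      ∀ z : ℂ, ‖z‖ < 1 → ∫ t, poisson t z • b t ∂m = g z := by
  have hc := fun j => continuous_comp_radius hg.1 j
  have hb : ∀ j (t : Circle), ‖conj (g (radius j * t))‖ ≤ 1 := fun j t => by
    rw [Complex.norm_conj]
    exact hg.2 _ (mem_ball_zero_iff.2 (norm_radius_mul_lt j (Circle.norm_coe t).le))
  have hmem : ∀ j, MemLp (fun t : Circle => conj (g (radius j * t))) 2 m := fun j =>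
    MemLp.of_bound (Complex.continuous_conj.comp (hc j)).aestronglyMeasurable 1
      (Eventually.of_forall (hb j))
  -- The dilates are bounded in `L²`; a weak-* cluster point of the functionals they represent is
  -- the boundary function. They are conjugated because the inner product is conjugate-linear in its
  -- first slot, and an ultrafilter limit replaces the extraction of a subsequence.
  let v : ℕ → Lp ℂ 2 m := fun j => (hmem j).toLp _
  let x : ℕ → WeakDual ℂ (Lp ℂ 2 m) := fun j =>
    StrongDual.toWeakDual (InnerProductSpace.toDual ℂ (Lp ℂ 2 m) (v j))
  obtain ⟨R, hR⟩ : ∃ R : ℝ, ∀ j, ‖v j‖ ≤ R := by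
    refine ⟨_, fun j => Lp.norm_le_of_ae_bound zero_le_one ?_⟩
    filter_upwards [(hmem j).coeFn_toLp] with t ht
    rw [ht]
    exact hb j t
  have hx : ∀ j, x j ∈ WeakDual.toStrongDual ⁻¹'
      Metric.closedBall (0 : StrongDual ℂ (Lp ℂ 2 m)) R := fun j => by
    rw [Set.mem_preimage, mem_closedBall_zero_iff]
    exact ((InnerProductSpace.toDual ℂ (Lp ℂ 2 m)).norm_map (v j)).le.trans (hR j)
  obtain ⟨Φ, -, hΦ⟩ := (WeakDual.isCompact_closedBall (𝕜 := ℂ) (0 : StrongDual ℂ (Lp ℂ 2 m))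
    R).ultrafilter_le_nhds ((hyperfilter ℕ).map x)
    (le_principal_iff.2 (mem_map.2 (Eventually.of_forall hx)))
  have hΦ : Tendsto x (hyperfilter ℕ) (𝓝 Φ) := hΦ
  let y : Lp ℂ 2 m := (InnerProductSpace.toDual ℂ (Lp ℂ 2 m)).symm (WeakDual.toStrongDual Φ)
  have hy : MemLp (fun t => conj (y t)) 2 m := (Lp.memLp y).star
  refine ⟨fun t => conj (y t), hy.integrable one_le_two, fun z hz => ?_⟩
  have hpm : MemLp (fun t => (poisson t z : ℂ)) 2 m := by
    obtain ⟨C, hC⟩ := (isCompact_univ (X := Circle)).exists_bound_of_continuousOn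
      (Complex.continuous_ofReal.comp (continuous_poisson hz)).continuousOn
    exact MemLp.of_bound
      (Complex.continuous_ofReal.comp (continuous_poisson hz)).aestronglyMeasurable C
      (Eventually.of_forall fun t => hC t trivial)
  have h1 : Tendsto (fun j => x j (hpm.toLp _)) (hyperfilter ℕ) (𝓝 (Φ (hpm.toLp _))) :=
    ((WeakDual.eval_continuous _).tendsto Φ).comp hΦ
  have h2 : ∀ j, x j (hpm.toLp _) = g (radius j * z) := fun j => by
    have : x j (hpm.toLp _) = inner ℂ (v j) (hpm.toLp _) := rfl
    rw [this, L2.inner_def, ← integral_poisson_smul (diffContOnCl_comp_radius hg.1 j) hz]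
    refine integral_congr_ae ?_
    filter_upwards [(hmem j).coeFn_toLp, hpm.coeFn_toLp] with t ht1 ht2
    rw [ht1, ht2, RCLike.inner_apply]
    simp
  have h3 : Tendsto (fun j => g (radius j * z)) atTop (𝓝 (g z)) :=
    ((hg.1.continuousOn.continuousAt (Metric.isOpen_ball.mem_nhds
      (mem_ball_zero_iff.2 hz))).tendsto).comp (tendsto_radius_mul z)
  simp_rw [h2] at h1
  rw [← tendsto_nhds_unique h1 (h3.mono_left Nat.hyperfilter_le_atTop)]
  have h4 : Φ (hpm.toLp _) = inner ℂ y (hpm.toLp _) :=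
    (InnerProductSpace.toDual_symm_apply (𝕜 := ℂ) (x := hpm.toLp _)
      (y := WeakDual.toStrongDual Φ)).symm
  rw [h4, L2.inner_def]
  refine integral_congr_ae ?_
  filter_upwards [hpm.coeFn_toLp] with t ht
  rw [ht, RCLike.inner_apply, Complex.real_smul]

lemma integrable_poisson_smul {E : Type*} [NormedAddCommGroup E] [NormedSpace ℝ E]
    {b : Circle → E} (hb : Integrable b m) {z : ℂ} (hz : ‖z‖ < 1) :
    Integrable (fun t => poisson t z • b t) m := by
  obtain ⟨C, hC⟩ := (isCompact_univ (X := Circle)).exists_bound_of_continuousOn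
    (continuous_poisson hz).continuousOn
  exact hb.bdd_smul C (continuous_poisson hz).aestronglyMeasurable
    (Eventually.of_forall fun t => hC t trivial)

lemma norm_integral_poisson_sub_le {E : Type*} [NormedAddCommGroup E] [NormedSpace ℝ E]
    [CompleteSpace E] {b : Circle → E} (hb : Integrable b m) {z : ℂ} (hz : ‖z‖ < 1) (c : E) :
    ‖∫ t, poisson t z • b t ∂m - c‖ ≤ ∫ t, ‖b t - c‖ * poisson t z ∂m := by
  have h1 : c = ∫ t, poisson t z • c ∂m := by
    rw [integral_smul_const, integral_poisson hz, one_smul]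
  conv_lhs => rw [h1]
  rw [← integral_sub (integrable_poisson_smul hb hz)
    (integrable_poisson_smul (integrable_const c) hz)]
  refine (norm_integral_le_integral_norm _).trans (le_of_eq (integral_congr_ae ?_))
  refine Eventually.of_forall fun t => ?_
  beta_reduce
  rw [← smul_sub, norm_smul, Real.norm_of_nonneg (poisson_nonneg hz t), mul_comm]

/-- Poisson integrals converge nontangentially at Lebesgue points. -/
lemma tendsto_integral_poisson_smul {E : Type*} [NormedAddCommGroup E] [NormedSpace ℝ E]
    [CompleteSpace E] {b : Circle → E} (hb : Integrable b m) {ξ : Circle}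
    (h : Tendsto (fun r : ℝ => (∫ t in Metric.ball ξ r, ‖b t - b ξ‖ ∂m) / r) (𝓝[>] 0) (𝓝 0)) :
    Tendsto (fun z => ∫ t, poisson t z • b t ∂m) (nontangential ξ) (𝓝 (b ξ)) := by
  refine tendsto_iSup.2 fun M => tendsto_iff_norm_sub_tendsto_zero.2 ?_
  refine squeeze_zero' (Eventually.of_forall fun z => norm_nonneg _) ?_
    (tendsto_integral_mul_poisson_stolz (fun _ => norm_nonneg _)
      (hb.sub (integrable_const (b ξ))).norm h M)
  filter_upwards [self_mem_nhdsWithin] with z hz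
  exact norm_integral_poisson_sub_le hb hz.1 (b ξ)

lemma eventually_nontangential (ξ : Circle) : ∀ᶠ z in nontangential ξ, ‖z‖ < 1 :=
  mem_iSup.2 fun _ => mem_of_superset self_mem_nhdsWithin fun _ hz => hz.1

lemma nontangential_le (ξ : Circle) : nontangential ξ ≤ 𝓝[Metric.ball 0 1] (ξ : ℂ) :=
  iSup_le fun _ => nhdsWithin_mono _ fun _ hz => mem_ball_zero_iff.2 hz.1

/-- Fatou's theorem for Schur functions. -/
theorem IsSchur.fatou {g : ℂ → ℂ} (hg : IsSchur g) :
    (∀ᵐ ξ ∂m, Tendsto g (nontangential ξ) (𝓝 (trace g ξ))) ∧ Integrable (trace g) m ∧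
      ∀ z : ℂ, ‖z‖ < 1 → ∫ t, poisson t z • trace g t ∂m = g z := by
  obtain ⟨b, hb, hbg⟩ := hg.exists_poisson
  have h1 : ∀ᵐ ξ ∂m, Tendsto g (nontangential ξ) (𝓝 (b ξ)) := by
    filter_upwards [ae_tendsto_integral_ball_div hb] with ξ hξ
    refine (tendsto_integral_poisson_smul hb hξ).congr' ?_
    filter_upwards [eventually_nontangential ξ] with z hz using hbg z hz
  have h2 : trace g =ᵐ[m] b := by
    filter_upwards [h1] with ξ hξ using hξ.limUnder_eq
  refine ⟨?_, hb.congr h2.symm, fun z hz => ?_⟩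
  · filter_upwards [h1, h2] with ξ hξ h using h ▸ hξ
  · rw [← hbg z hz]
    refine integral_congr_ae ?_
    filter_upwards [h2] with t ht
    rw [ht]

lemma IsSchur.norm_trace_le {g : ℂ → ℂ} (hg : IsSchur g) {ξ : Circle}
    (h : Tendsto g (nontangential ξ) (𝓝 (trace g ξ))) : ‖trace g ξ‖ ≤ 1 := by
  refine le_of_tendsto h.norm ?_
  filter_upwards [eventually_nontangential ξ] with z hz using hg.2 z (mem_ball_zero_iff.2 hz)

/-- Fatou's lemma along radii, for an analytic function with nonnegative real part. -/
lemma lintegral_liminf_re_le {h : ℂ → ℂ} (hh : DifferentiableOn ℂ h (Metric.ball 0 1))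
    (hre : ∀ z ∈ Metric.ball (0 : ℂ) 1, 0 ≤ (h z).re) {a : ℂ} (ha : ‖a‖ < 1) :
    ∫⁻ t : Circle, liminf (fun j => ENNReal.ofReal (poisson t a * (h (radius j * t)).re)) atTop ∂m
      ≤ ENNReal.ofReal (h a).re := by
  have hc := fun j => continuous_comp_radius hh j
  have hc' : ∀ j, Continuous fun t : Circle => poisson t a * (h (radius j * t)).re := fun j =>
    (continuous_poisson ha).mul (Complex.continuous_re.comp (hc j))
  have hj : ∀ j, ∫⁻ t : Circle, ENNReal.ofReal (poisson t a * (h (radius j * t)).re) ∂m =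
      ENNReal.ofReal (h (radius j * a)).re := fun j => by
    rw [← ofReal_integral_eq_lintegral_ofReal (integrable_of_continuous (hc' j) m)]
    · rw [← integral_poisson_smul (diffContOnCl_comp_radius hh j) ha]
      refine congrArg _ (Eq.trans ?_ (integral_re (𝕜 := ℂ) (integrable_of_continuous
        ((continuous_poisson ha).smul (hc j)) m)))
      simp
    · exact Eventually.of_forall fun t => mul_nonneg (poisson_nonneg ha t)
        (hre _ (mem_ball_zero_iff.2 (norm_radius_mul_lt j (Circle.norm_coe t).le)))
  refine (lintegral_liminf_le fun j => (hc' j).measurable.ennreal_ofReal).trans ?_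
  simp_rw [hj]
  refine le_of_eq (Tendsto.liminf_eq ?_)
  have h3 : Tendsto (fun j => h (radius j * a)) atTop (𝓝 (h a)) :=
    ((hh.continuousOn.continuousAt (Metric.isOpen_ball.mem_nhds
      (mem_ball_zero_iff.2 ha))).tendsto).comp (tendsto_radius_mul a)
  exact (ENNReal.continuous_ofReal.comp Complex.continuous_re).continuousAt.tendsto.comp h3

lemma one_sub_re_pos {w : ℂ} (hw : ‖w‖ < 1) : 0 < (1 - w).re := by
  have := (Complex.re_le_norm w).trans_lt hw
  simpa using this

lemma one_sub_ne_zero {w : ℂ} (hw : ‖w‖ < 1) : 1 - w ≠ 0 := fun h => by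
  have := one_sub_re_pos hw
  rw [h] at this
  simp at this

/-- The boundary values of a Schur function of modulus less than one differ from one almost
everywhere. -/
lemma ae_trace_ne_one {g : ℂ → ℂ} (hg : IsSchur g) (hlt : ∀ z : ℂ, ‖z‖ < 1 → ‖g z‖ < 1) :
    ∀ᵐ t ∂m, trace g t ≠ 1 := by
  -- The real part `log 2 - log |1 - g|` is nonnegative in the disk and tends to infinity radially
  -- where the boundary value is `1`. Fatou's lemma at the centre keeps its radial lower limit
  -- almost everywhere finite.
  have hh : DifferentiableOn ℂ (fun z => (Real.log 2 : ℂ) - Complex.log (1 - g z))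
      (Metric.ball 0 1) := by
    refine (differentiableOn_const _).sub (DifferentiableOn.clog (hg.1.const_sub 1) fun z hz => ?_)
    exact Or.inl (one_sub_re_pos (hlt z (mem_ball_zero_iff.1 hz)))
  have hval : ∀ z, ((Real.log 2 : ℂ) - Complex.log (1 - g z)).re =
      Real.log 2 - Real.log ‖1 - g z‖ := fun z => by
    rw [Complex.sub_re, Complex.ofReal_re, Complex.log_re]
  have hle := lintegral_liminf_re_le hh (fun z hz => by
    have hz := hlt z (mem_ball_zero_iff.1 hz)
    rw [hval, sub_nonneg]
    refine Real.log_le_log (norm_pos_iff.2 (one_sub_ne_zero hz)) ?_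
    refine (norm_sub_le _ _).trans ?_
    rw [norm_one]; linarith) (a := 0) (by simp)
  have hlt' := hle.trans_lt ENNReal.ofReal_lt_top
  have hp : ∀ t : Circle, poisson t 0 = 1 := fun t => by simp [poisson, Circle.norm_coe]
  simp only [hval, hp, one_mul] at hlt'
  have hmeas : Measurable fun t : Circle => liminf (fun j => ENNReal.ofReal
      (Real.log 2 - Real.log ‖1 - g (radius j * t)‖)) atTop := by
    refine Measurable.liminf fun j => ?_
    have := (continuous_comp_radius hg.1 j).measurable
    exact (measurable_const.sub (measurable_const.sub this).norm.log).ennreal_ofReal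
  filter_upwards [ae_lt_top hmeas hlt'.ne, hg.fatou.1] with t ht htr h1
  rw [h1] at htr
  have h2 : Tendsto (fun j => ‖1 - g (radius j * t)‖) atTop (𝓝[≠] 0) := by
    refine tendsto_nhdsWithin_iff.2 ⟨?_, Eventually.of_forall fun j => ?_⟩
    · have := ((htr.comp (tendsto_radius_nontangential t)).const_sub 1).norm
      simpa using this
    · exact norm_ne_zero_iff.2 (one_sub_ne_zero
        (hlt _ (norm_radius_mul_lt j (Circle.norm_coe t).le)))
  have h3 : Tendsto (fun j => ENNReal.ofReal (Real.log 2 - Real.log ‖1 - g (radius j * t)‖)) atTop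
      (𝓝 ⊤) := by
    refine ENNReal.tendsto_ofReal_atTop.comp ?_
    simp_rw [sub_eq_add_neg]
    exact tendsto_atTop_add_const_left _ _
      (tendsto_neg_atBot_atTop.comp (Real.tendsto_log_nhdsNE_zero.comp h2))
  rw [h3.liminf_eq] at ht
  exact lt_irrefl _ ht

lemma re_cayley (w : ℂ) : ((1 + w) / (1 - w)).re = (1 - ‖w‖ ^ 2) / ‖1 - w‖ ^ 2 := by
  have := congrFun (poissonKernel_eq_re_herglotzRieszKernel (c := 0) (w := w)) 1
  simpa [poissonKernel_def, herglotzRieszKernel_def] using this.symm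

/-- Fatou's lemma on the dilates; only an inequality survives, since the boundary measure of the
Cayley transform may have a singular part. -/
lemma lintegral_trace_cayley_le {g : ℂ → ℂ} (hg : IsSchur g)
    (hlt : ∀ z : ℂ, ‖z‖ < 1 → ‖g z‖ < 1) {a : ℂ} (ha : ‖a‖ < 1) :
    ∫⁻ t, ENNReal.ofReal ((1 - ‖trace g t‖ ^ 2) / ‖1 - trace g t‖ ^ 2 * poisson t a) ∂m ≤
      ENNReal.ofReal ((1 + g a) / (1 - g a)).re := by
  have hh : DifferentiableOn ℂ (fun z => (1 + g z) / (1 - g z)) (Metric.ball 0 1) :=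
    (hg.1.const_add 1).div (hg.1.const_sub 1) fun z hz =>
      one_sub_ne_zero (hlt z (mem_ball_zero_iff.1 hz))
  have hle := lintegral_liminf_re_le hh (fun z hz => by
    have := hlt z (mem_ball_zero_iff.1 hz)
    have : 0 ≤ 1 - ‖g z‖ ^ 2 := by nlinarith [norm_nonneg (g z)]
    rw [re_cayley]; positivity) ha
  refine le_trans (le_of_eq (lintegral_congr_ae ?_)) hle
  filter_upwards [ae_trace_ne_one hg hlt, hg.fatou.1] with t ht htr
  have h1 := htr.comp (tendsto_radius_nontangential t)
  have h2 : Tendsto (fun j => (1 + g (radius j * t)) / (1 - g (radius j * t))) atTop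
      (𝓝 ((1 + trace g t) / (1 - trace g t))) :=
    (h1.const_add 1).div (h1.const_sub 1) (sub_ne_zero.2 ht.symm)
  have h3 := ((Complex.continuous_re.tendsto _).comp h2).const_mul (poisson t a)
  have h4 := (ENNReal.continuous_ofReal.tendsto _).comp h3
  rw [← re_cayley, mul_comm]
  exact h4.liminf_eq.symm


/-! ### Blaschke factors and the inverse Schur step. -/

/-- The elementary Blaschke factor vanishing at `a`. -/
noncomputable def blaschkeFactor (a z : ℂ) : ℂ := (z - a) / (1 - conj a * z)

/-- The inverse of one step of the Schur algorithm, with parameter `γ` and Blaschke factor `s`. -/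
noncomputable def inverseStep (γ s v : ℂ) : ℂ := (γ + s * v) / (1 + conj γ * (s * v))

lemma norm_sq_sub_norm_sq (γ u : ℂ) :
    ‖1 + conj γ * u‖ ^ 2 - ‖γ + u‖ ^ 2 = (1 - ‖γ‖ ^ 2) * (1 - ‖u‖ ^ 2) := by
  simp only [← Complex.normSq_eq_norm_sq, Complex.normSq_apply, Complex.add_re, Complex.add_im,
    Complex.mul_re, Complex.mul_im, Complex.conj_re, Complex.conj_im, Complex.one_re,
    Complex.one_im]
  ring

lemma one_add_conj_mul_ne_zero {γ u : ℂ} (hγ : ‖γ‖ < 1) (hu : ‖u‖ ≤ 1) : 1 + conj γ * u ≠ 0 := by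
  have h : ‖-(conj γ * u)‖ < 1 := by
    rw [norm_neg, norm_mul, Complex.norm_conj]
    nlinarith [norm_nonneg γ, norm_nonneg u]
  simpa using one_sub_ne_zero h

lemma one_sub_mul_ne_zero {γ u : ℂ} (hγ : ‖γ‖ < 1) (hu : ‖u‖ ≤ 1) : 1 - γ * u ≠ 0 := by
  apply one_sub_ne_zero
  rw [norm_mul]
  nlinarith [norm_nonneg γ, norm_nonneg u]

lemma one_sub_conj_mul_ne_zero {a z : ℂ} (ha : ‖a‖ < 1) (hz : ‖z‖ ≤ 1) : 1 - conj a * z ≠ 0 :=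
  one_sub_mul_ne_zero (by rwa [Complex.norm_conj]) hz

lemma one_sub_norm_sq_div {γ u : ℂ} (h : 1 + conj γ * u ≠ 0) :
    1 - ‖(γ + u) / (1 + conj γ * u)‖ ^ 2 =
      (1 - ‖γ‖ ^ 2) * (1 - ‖u‖ ^ 2) / ‖1 + conj γ * u‖ ^ 2 := by
  have : ‖1 + conj γ * u‖ ≠ 0 := norm_ne_zero_iff.2 h
  rw [← norm_sq_sub_norm_sq, sub_div, div_self (pow_ne_zero 2 this), norm_div, div_pow]

lemma one_sub_norm_sq_pos {γ : ℂ} (hγ : ‖γ‖ < 1) : 0 < 1 - ‖γ‖ ^ 2 := by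
  nlinarith [norm_nonneg γ]

lemma norm_moebius_le {γ u : ℂ} (hγ : ‖γ‖ < 1) (hu : ‖u‖ ≤ 1) :
    ‖(γ + u) / (1 + conj γ * u)‖ ≤ 1 := by
  have h := one_sub_norm_sq_div (one_add_conj_mul_ne_zero hγ hu)
  have h1 := (one_sub_norm_sq_pos hγ).le
  have h2 : 0 ≤ 1 - ‖u‖ ^ 2 := by nlinarith [norm_nonneg u]
  have : 0 ≤ 1 - ‖(γ + u) / (1 + conj γ * u)‖ ^ 2 := by rw [h]; positivity
  nlinarith [norm_nonneg ((γ + u) / (1 + conj γ * u))]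

lemma norm_moebius_lt {γ u : ℂ} (hγ : ‖γ‖ < 1) (hu : ‖u‖ < 1) :
    ‖(γ + u) / (1 + conj γ * u)‖ < 1 := by
  have h0 := one_add_conj_mul_ne_zero hγ hu.le
  have h := one_sub_norm_sq_div h0
  have h1 := one_sub_norm_sq_pos hγ
  have h2 := one_sub_norm_sq_pos hu
  have h3 : 0 < ‖1 + conj γ * u‖ := norm_pos_iff.2 h0
  have : 0 < 1 - ‖(γ + u) / (1 + conj γ * u)‖ ^ 2 := by rw [h]; positivity
  nlinarith [norm_nonneg ((γ + u) / (1 + conj γ * u))]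

lemma norm_moebius_eq {γ u : ℂ} (hγ : ‖γ‖ < 1) (hu : ‖u‖ = 1) :
    ‖(γ + u) / (1 + conj γ * u)‖ = 1 := by
  have h := one_sub_norm_sq_div (one_add_conj_mul_ne_zero hγ hu.le)
  rw [hu] at h
  have h' : ‖(γ + u) / (1 + conj γ * u)‖ ^ 2 = 1 := by
    have : (1 - ‖γ‖ ^ 2) * (1 - 1 ^ 2) / ‖1 + conj γ * u‖ ^ 2 = 0 := by ring
    linarith
  exact (pow_eq_one_iff_of_nonneg (norm_nonneg _) two_ne_zero).1 h'

/-- Blaschke factors are Möbius maps with parameter `-a`, so they inherit the norm estimates above.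
-/
lemma blaschkeFactor_eq (a z : ℂ) :
    blaschkeFactor a z = (-a + z) / (1 + conj (-a) * z) := by
  rw [blaschkeFactor, map_neg]; congr 1 <;> ring

lemma norm_blaschkeFactor_le {a z : ℂ} (ha : ‖a‖ < 1) (hz : ‖z‖ ≤ 1) :
    ‖blaschkeFactor a z‖ ≤ 1 := by
  rw [blaschkeFactor_eq]; exact norm_moebius_le (by rwa [norm_neg]) hz

lemma norm_blaschkeFactor_lt {a z : ℂ} (ha : ‖a‖ < 1) (hz : ‖z‖ < 1) :
    ‖blaschkeFactor a z‖ < 1 := by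
  rw [blaschkeFactor_eq]; exact norm_moebius_lt (by rwa [norm_neg]) hz

lemma norm_blaschkeFactor_eq {a z : ℂ} (ha : ‖a‖ < 1) (hz : ‖z‖ = 1) :
    ‖blaschkeFactor a z‖ = 1 := by
  rw [blaschkeFactor_eq]; exact norm_moebius_eq (by rwa [norm_neg]) hz

@[simp] lemma blaschkeFactor_self (a : ℂ) : blaschkeFactor a a = 0 := by simp [blaschkeFactor]

lemma blaschkeFactor_neg_blaschkeFactor {a z : ℂ} (ha : ‖a‖ < 1) (hz : ‖z‖ ≤ 1) :
    blaschkeFactor (-a) (blaschkeFactor a z) = z := by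
  have h1 := one_sub_conj_mul_ne_zero ha hz
  have h2 := one_sub_conj_mul_ne_zero ha ha.le
  have h3 : 1 + conj a * blaschkeFactor a z = (1 - conj a * a) / (1 - conj a * z) := by
    rw [blaschkeFactor, eq_div_iff h1, add_mul, mul_assoc, div_mul_cancel₀ _ h1]
    ring
  have h4 : blaschkeFactor a z + a = z * (1 - conj a * a) / (1 - conj a * z) := by
    rw [blaschkeFactor, eq_div_iff h1, add_mul, div_mul_cancel₀ _ h1]
    ring
  rw [blaschkeFactor, map_neg, neg_mul, sub_neg_eq_add, sub_neg_eq_add, h3, h4,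
    div_div_div_cancel_right₀ h1, mul_div_cancel_right₀ _ h2]

lemma norm_inverseStep_le {γ s v : ℂ} (hγ : ‖γ‖ < 1) (hs : ‖s‖ ≤ 1) (hv : ‖v‖ ≤ 1) :
    ‖inverseStep γ s v‖ ≤ 1 :=
  norm_moebius_le hγ (by rw [norm_mul]; exact mul_le_one₀ hs (norm_nonneg _) hv)

lemma norm_inverseStep_lt {γ s v : ℂ} (hγ : ‖γ‖ < 1) (hs : ‖s‖ ≤ 1) (hv : ‖v‖ < 1) :
    ‖inverseStep γ s v‖ < 1 :=
  norm_moebius_lt hγ 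
    ((norm_mul s v).trans_lt (mul_lt_one_of_nonneg_of_lt_one_right hs (norm_nonneg _) hv))

lemma tendsto_blaschkeFactor {ι : Type*} {l : Filter ι} {a : ℂ} (ha : ‖a‖ < 1) {z : ι → ℂ} {z₀ : ℂ}
    (hz₀ : ‖z₀‖ ≤ 1) (hz : Tendsto z l (𝓝 z₀)) :
    Tendsto (fun i => blaschkeFactor a (z i)) l (𝓝 (blaschkeFactor a z₀)) :=
  (hz.sub_const a).div ((hz.const_mul _).const_sub 1) (one_sub_conj_mul_ne_zero ha hz₀)

lemma tendsto_inverseStep {ι : Type*} {l : Filter ι} {γ : ℂ} (hγ : ‖γ‖ < 1) {s v : ι → ℂ}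
    {s₀ v₀ : ℂ} (hs₀ : ‖s₀‖ ≤ 1) (hv₀ : ‖v₀‖ ≤ 1) (hs : Tendsto s l (𝓝 s₀))
    (hv : Tendsto v l (𝓝 v₀)) :
    Tendsto (fun i => inverseStep γ (s i) (v i)) l (𝓝 (inverseStep γ s₀ v₀)) :=
  ((hs.mul hv).const_add γ).div (((hs.mul hv).const_mul _).const_add 1)
    (one_add_conj_mul_ne_zero hγ (by rw [norm_mul]; exact mul_le_one₀ hs₀ (norm_nonneg _) hv₀))

lemma differentiableOn_blaschkeFactor {a : ℂ} (ha : ‖a‖ < 1) :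
    DifferentiableOn ℂ (blaschkeFactor a) (Metric.ball 0 1) := by
  refine DifferentiableOn.div (by fun_prop) (by fun_prop) fun z hz => ?_
  exact one_sub_conj_mul_ne_zero ha (mem_ball_zero_iff.1 hz).le

lemma differentiableOn_inverseStep {γ : ℂ} (hγ : ‖γ‖ < 1) {s v : ℂ → ℂ} {S : Set ℂ}
    (hs : DifferentiableOn ℂ s S) (hv : DifferentiableOn ℂ v S)
    (hs' : ∀ z ∈ S, ‖s z‖ ≤ 1) (hv' : ∀ z ∈ S, ‖v z‖ ≤ 1) :
    DifferentiableOn ℂ (fun z => inverseStep γ (s z) (v z)) S := by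
  refine ((hs.mul hv).const_add γ).div (((hs.mul hv).const_mul _).const_add 1) fun z hz => ?_
  refine one_add_conj_mul_ne_zero hγ ?_
  rw [norm_mul]
  exact mul_le_one₀ (hs' z hz) (norm_nonneg _) (hv' z hz)

/-! ### Wall approximants and the factorization of the boundary density. -/

section Wall

/-- The linear fractional map expressing a Schur function through its `n`-th remainder. -/
noncomputable def wallMap (a γ : ℕ → ℂ) : ℕ → ℂ → ℂ → ℂ
  | 0, _, v => v
  | n + 1, z, v => wallMap a γ n z (inverseStep (γ n) (blaschkeFactor (a n) z) v)

/-- The inverse Schur iterates. -/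
noncomputable def inverseIterate (a γ : ℕ → ℂ) : ℕ → ℂ → ℂ
  | 0, z => z
  | n + 1, z => blaschkeFactor (a n) z *
      ((inverseIterate a γ n z - conj (γ n)) / (1 - γ n * inverseIterate a γ n z))

/-- The reciprocal of the density on the circle of the `n`-th Wall approximant. -/
noncomputable def wallWeight (a γ : ℕ → ℂ) : ℕ → ℂ → ℝ
  | 0, _ => 1
  | n + 1, z => wallWeight a γ n z *
      (‖1 - γ n * inverseIterate a γ n z‖ ^ 2 / (1 - ‖γ n‖ ^ 2))

variable {a γ : ℕ → ℂ} (ha : ∀ n, ‖a n‖ < 1) (hγ : ∀ n, ‖γ n‖ < 1)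
include ha hγ

lemma norm_wallMap_lt (n : ℕ) {z v : ℂ} (hz : ‖z‖ ≤ 1) (hv : ‖v‖ < 1) :
    ‖wallMap a γ n z v‖ < 1 := by
  induction n generalizing v with
  | zero => exact hv
  | succ n ih => exact ih (norm_inverseStep_lt (hγ n) (norm_blaschkeFactor_le (ha n) hz) hv)

lemma tendsto_wallMap (n : ℕ) {ι : Type*} {l : Filter ι} {z v : ι → ℂ} {z₀ v₀ : ℂ}
    (hz₀ : ‖z₀‖ ≤ 1) (hv₀ : ‖v₀‖ ≤ 1) (hz : Tendsto z l (𝓝 z₀)) (hv : Tendsto v l (𝓝 v₀)) :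
    Tendsto (fun i => wallMap a γ n (z i) (v i)) l (𝓝 (wallMap a γ n z₀ v₀)) := by
  induction n generalizing v v₀ with
  | zero => exact hv
  | succ n ih =>
    exact ih (norm_inverseStep_le (hγ n) (norm_blaschkeFactor_le (ha n) hz₀) hv₀)
      (tendsto_inverseStep (hγ n) (norm_blaschkeFactor_le (ha n) hz₀) hv₀
        (tendsto_blaschkeFactor (ha n) hz₀ hz) hv)

lemma differentiableOn_wallMap (n : ℕ) {v : ℂ → ℂ}
    (hv : DifferentiableOn ℂ v (Metric.ball 0 1)) (hv' : ∀ z ∈ Metric.ball (0 : ℂ) 1, ‖v z‖ ≤ 1) :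
    DifferentiableOn ℂ (fun z => wallMap a γ n z (v z)) (Metric.ball 0 1) := by
  have hb : ∀ n, ∀ z ∈ Metric.ball (0 : ℂ) 1, ‖blaschkeFactor (a n) z‖ ≤ 1 := fun n z hz =>
    norm_blaschkeFactor_le (ha n) (mem_ball_zero_iff.1 hz).le
  induction n generalizing v with
  | zero => exact hv
  | succ n ih =>
    exact ih (differentiableOn_inverseStep (hγ n) (differentiableOn_blaschkeFactor (ha n)) hv
      (hb n) hv') fun z hz => norm_inverseStep_le (hγ n) (hb n z hz) (hv' z hz)

lemma norm_inverseIterate_le (n : ℕ) {z : ℂ} (hz : ‖z‖ ≤ 1) : ‖inverseIterate a γ n z‖ ≤ 1 := by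
  induction n with
  | zero => exact hz
  | succ n ih =>
    rw [inverseIterate, norm_mul]
    refine mul_le_one₀ (norm_blaschkeFactor_le (ha n) hz) (norm_nonneg _) ?_
    simpa [blaschkeFactor] using norm_blaschkeFactor_le (a := conj (γ n)) (by simpa using hγ n) ih

lemma norm_inverseIterate_eq (n : ℕ) {z : ℂ} (hz : ‖z‖ = 1) : ‖inverseIterate a γ n z‖ = 1 := by
  induction n with
  | zero => exact hz
  | succ n ih =>
    rw [inverseIterate, norm_mul, norm_blaschkeFactor_eq (ha n) hz, one_mul]
    simpa [blaschkeFactor] using norm_blaschkeFactor_eq (a := conj (γ n)) (by simpa using hγ n) ih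

lemma tendsto_inverseIterate (n : ℕ) {ι : Type*} {l : Filter ι} {z : ι → ℂ} {z₀ : ℂ}
    (hz₀ : ‖z₀‖ ≤ 1) (hz : Tendsto z l (𝓝 z₀)) :
    Tendsto (fun i => inverseIterate a γ n (z i)) l (𝓝 (inverseIterate a γ n z₀)) := by
  induction n with
  | zero => exact hz
  | succ n ih =>
    refine (tendsto_blaschkeFactor (ha n) hz₀ hz).mul ((ih.sub_const _).div
      ((ih.const_mul _).const_sub 1) ?_)
    exact one_sub_mul_ne_zero (hγ n) (norm_inverseIterate_le ha hγ n hz₀)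

lemma differentiableOn_inverseIterate (n : ℕ) :
    DifferentiableOn ℂ (inverseIterate a γ n) (Metric.ball 0 1) := by
  induction n with
  | zero => exact differentiableOn_id
  | succ n ih =>
    refine (differentiableOn_blaschkeFactor (ha n)).mul ((ih.sub_const _).div
      ((ih.const_mul _).const_sub 1) fun z hz => ?_)
    exact one_sub_mul_ne_zero (hγ n)
      (norm_inverseIterate_le ha hγ n (mem_ball_zero_iff.1 hz).le)

lemma wallWeight_pos (n : ℕ) {z : ℂ} (hz : ‖z‖ ≤ 1) : 0 < wallWeight a γ n z := by
  induction n with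
  | zero => exact one_pos
  | succ n ih =>
    have h1 := one_sub_norm_sq_pos (hγ n)
    have h2 : 0 < ‖1 - γ n * inverseIterate a γ n z‖ :=
      norm_pos_iff.2 (one_sub_mul_ne_zero (hγ n) (norm_inverseIterate_le ha hγ n hz))
    rw [wallWeight]; positivity

lemma continuous_wallWeight (n : ℕ) : Continuous fun t : Circle => wallWeight a γ n t := by
  induction n with
  | zero => exact continuous_const
  | succ n ih =>
    refine ih.mul (((continuous_const.sub (continuous_const.mul ?_)).norm.pow 2).div_const _)
    exact continuous_iff_continuousAt.2 fun t => tendsto_inverseIterate ha hγ n (Circle.norm_coe t).le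
      (show Continuous fun t : Circle => (t : ℂ) by fun_prop).continuousAt

/-- On the unit circle, the boundary density of a Schur function factors through the `n`-th
remainder. -/
lemma density_wallMap_mul_wallWeight (n : ℕ) {z v : ℂ} (hz : ‖z‖ = 1) (hv : ‖v‖ ≤ 1) :
    (1 - ‖wallMap a γ n z v‖ ^ 2) / ‖1 - z * wallMap a γ n z v‖ ^ 2 * wallWeight a γ n z =
      (1 - ‖v‖ ^ 2) / ‖1 - inverseIterate a γ n z * v‖ ^ 2 := by
  induction n generalizing v with
  | zero => simp [wallMap, wallWeight, inverseIterate]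
  | succ n ih =>
    have hs := norm_blaschkeFactor_eq (ha n) hz
    rw [wallMap, wallWeight, ← mul_assoc,
      ih (norm_inverseStep_le (hγ n) hs.le hv), inverseIterate]
    set G := inverseIterate a γ n z
    set s := blaschkeFactor (a n) z
    have hG1 : ‖G‖ ≤ 1 := norm_inverseIterate_le ha hγ n hz.le
    have hsv : ‖s * v‖ = ‖v‖ := by rw [norm_mul, hs, one_mul]
    have hD := one_add_conj_mul_ne_zero (hγ n) (hsv.le.trans hv)
    have hE := one_sub_mul_ne_zero (hγ n) hG1
    have h1 : 1 - ‖inverseStep (γ n) s v‖ ^ 2 =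
        (1 - ‖γ n‖ ^ 2) * (1 - ‖v‖ ^ 2) / ‖1 + conj (γ n) * (s * v)‖ ^ 2 := by
      rw [inverseStep, one_sub_norm_sq_div hD, hsv]
    -- The recursion for the inverse iterates is exactly what makes this factor again into `1 - G'
    -- v`, with `G'` the next iterate.
    have h2 : 1 - G * inverseStep (γ n) s v = (1 - γ n * G) *
        (1 - s * ((G - conj (γ n)) / (1 - γ n * G)) * v) / (1 + conj (γ n) * (s * v)) := by
      have h : (1 - γ n * G) * (1 - s * ((G - conj (γ n)) / (1 - γ n * G)) * v) =
          1 - γ n * G - s * (G - conj (γ n)) * v := by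
        generalize 1 - γ n * G = E at hE
        field_simp
      rw [inverseStep, h, eq_div_iff hD, sub_mul, ← mul_div_assoc, div_mul_cancel₀ _ hD]
      ring
    have h3 := (one_sub_norm_sq_pos (hγ n)).ne'
    have h4 : ‖1 + conj (γ n) * (s * v)‖ ≠ 0 := norm_ne_zero_iff.2 hD
    have h5 : ‖1 - γ n * G‖ ≠ 0 := norm_ne_zero_iff.2 hE
    rw [h1, h2, norm_div, norm_mul]
    generalize ‖1 + conj (γ n) * (s * v)‖ = d at h4
    generalize ‖1 - s * ((G - conj (γ n)) / (1 - γ n * G)) * v‖ = q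
    generalize ‖1 - γ n * G‖ = e at h5
    -- When the denominator `q` vanishes, both sides are `0` by the convention for division by zero.
    rcases eq_or_ne q 0 with rfl | hq
    · simp
    · field_simp

/-- The case `v = 0` of the density identity. -/
lemma inv_wallWeight (n : ℕ) {z : ℂ} (hz : ‖z‖ = 1) :
    (wallWeight a γ n z)⁻¹ =
      ((1 + z * wallMap a γ n z 0) / (1 - z * wallMap a γ n z 0)).re := by
  have h := density_wallMap_mul_wallWeight ha hγ n hz (v := 0) (by simp)
  rw [re_cayley, norm_mul, hz, one_mul]
  simp only [norm_zero, mul_zero, sub_zero, norm_one] at h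
  exact (eq_inv_of_mul_eq_one_left (by simpa using h)).symm

/-- The Poisson integral of the density of the `n`-th Wall approximant. -/
lemma integral_inv_wallWeight (n : ℕ) {b : ℂ} (hb : ‖b‖ < 1) :
    ∫ t : Circle, (wallWeight a γ n t)⁻¹ * poisson t b ∂m =
      ((1 + b * wallMap a γ n b 0) / (1 - b * wallMap a γ n b 0)).re := by
  -- The strict bound holds up to the boundary, so the Cayley transform is continuous on the closed
  -- disk and the Poisson formula applies directly.
  have hlt : ∀ z : ℂ, ‖z‖ ≤ 1 → ‖z * wallMap a γ n z 0‖ < 1 := fun z hz => by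
    rw [norm_mul]
    exact mul_lt_one_of_nonneg_of_lt_one_right hz (norm_nonneg _)
      (norm_wallMap_lt ha hγ n hz (by simp))
  have hd : DiffContOnCl ℂ (fun z => (1 + z * wallMap a γ n z 0) / (1 - z * wallMap a γ n z 0))
      (Metric.ball 0 1) := by
    have h1 : DifferentiableOn ℂ (fun z => z * wallMap a γ n z 0) (Metric.ball 0 1) :=
      differentiableOn_id.mul (differentiableOn_wallMap ha hγ n (differentiableOn_const 0)
        (by simp))
    have h2 : ContinuousOn (fun z => z * wallMap a γ n z 0) (closure (Metric.ball 0 1)) := by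
      rw [closure_ball _ one_ne_zero]
      refine continuousOn_id.mul fun z hz => ?_
      exact tendsto_wallMap ha hγ n (by simpa using hz) (by simp)
        (tendsto_id.mono_left nhdsWithin_le_nhds) tendsto_const_nhds
    refine ⟨(h1.const_add 1).div (h1.const_sub 1) fun z hz => one_sub_ne_zero
      (hlt z (mem_ball_zero_iff.1 hz).le), 
      (continuousOn_const.add h2).div (continuousOn_const.sub h2) fun z hz => ?_⟩
    rw [closure_ball _ one_ne_zero] at hz
    exact one_sub_ne_zero (hlt z (by simpa using hz))
  rw [← integral_poisson_smul hd hb]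
  have hi : Integrable (fun t : Circle => poisson t b •
      ((1 + t * wallMap a γ n t 0) / (1 - t * wallMap a γ n t 0) : ℂ)) m := by
    refine integrable_of_continuous ((continuous_poisson hb).smul ?_) m
    refine hd.continuousOn.comp_continuous (by fun_prop) fun t => ?_
    rw [closure_ball _ one_ne_zero]; simp [Circle.norm_coe]
  refine Eq.trans ?_ (integral_re (𝕜 := ℂ) hi)
  refine integral_congr_ae (Eventually.of_forall fun t => ?_)
  beta_reduce
  rw [inv_wallWeight ha hγ n (Circle.norm_coe t), mul_comm]
  simp

end Wall


/-! ### Finite Blaschke products as quotients of reciprocal polynomials. -/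

section FiniteBlaschke

open Polynomial

/-- `N / D` is a quotient of a polynomial of degree at most `n` by its reciprocal polynomial, the
latter having no zero in the closed unit disk. -/
structure IsReciprocalQuotient (n : ℕ) (N D : ℂ[X]) : Prop where
  natDegree_num : N.natDegree ≤ n
  natDegree_den : D.natDegree ≤ n
  eval_den : ∀ z : ℂ, z ≠ 0 → D.eval z = z ^ n * conj (N.eval (1 / conj z))
  den_ne_zero : ∀ z : ℂ, ‖z‖ ≤ 1 → D.eval z ≠ 0
  norm_le : ∀ z : ℂ, ‖z‖ ≤ 1 → ‖N.eval z / D.eval z‖ ≤ 1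

lemma IsReciprocalQuotient.eval_num {n : ℕ} {N D : ℂ[X]} (h : IsReciprocalQuotient n N D) {z : ℂ}
    (hz : z ≠ 0) : N.eval z = z ^ n * conj (D.eval (1 / conj z)) := by
  have hz' : conj z ≠ 0 := (_root_.map_ne_zero _).2 hz
  rw [h.eval_den _ (one_div_ne_zero hz')]
  simp [hz]

lemma isReciprocalQuotient_const {c : ℂ} (hc : ‖c‖ = 1) :
    IsReciprocalQuotient 0 (C c) (C (conj c)) where
  natDegree_num := by simp
  natDegree_den := by simp
  eval_den := by simp
  den_ne_zero := fun z _ => by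
    rw [eval_C, ← norm_ne_zero_iff, Complex.norm_conj, hc]
    exact one_ne_zero
  norm_le := fun z _ => by simp [hc]

lemma eval_step {a γ : ℂ} (ha : ‖a‖ < 1) {N D : ℂ[X]} {z : ℂ}
    (hz : ‖z‖ ≤ 1) (hD : D.eval z ≠ 0) :
    (C γ * (1 - C (conj a) * X) * D + (X - C a) * N).eval z /
      ((1 - C (conj a) * X) * D + C (conj γ) * (X - C a) * N).eval z =
      inverseStep γ (blaschkeFactor a z) (N.eval z / D.eval z) := by
  have h1 := one_sub_conj_mul_ne_zero ha hz
  have hE : (1 - conj a * z) * D.eval z ≠ 0 := mul_ne_zero h1 hD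
  have e : blaschkeFactor a z * (N.eval z / D.eval z) =
      (z - a) * N.eval z / ((1 - conj a * z) * D.eval z) := by
    rw [blaschkeFactor, div_mul_div_comm]
  rw [inverseStep, e]
  simp only [eval_add, eval_mul, eval_sub, eval_C, eval_X, eval_one]
  rw [← mul_div_mul_right (γ + _) _ hE, add_mul, add_mul, mul_assoc (conj γ) (_ / _),
    div_mul_cancel₀ _ hE, one_mul]
  congr 1 <;> ring

/-- Clearing denominators in an inverse Schur step raises the degree bound by one and respects the
reciprocal symmetry, so composing such steps never requires tracking zeros. -/
lemma IsReciprocalQuotient.step {n : ℕ} {N D : ℂ[X]} (h : IsReciprocalQuotient n N D) {a γ : ℂ}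
    (ha : ‖a‖ < 1) (hγ : ‖γ‖ < 1) :
    IsReciprocalQuotient (n + 1) (C γ * (1 - C (conj a) * X) * D + (X - C a) * N)
      ((1 - C (conj a) * X) * D + C (conj γ) * (X - C a) * N) where
  natDegree_num := by
    have := h.natDegree_num
    have := h.natDegree_den
    compute_degree
    omega
  natDegree_den := by
    have := h.natDegree_num
    have := h.natDegree_den
    compute_degree
    omega
  eval_den := fun z hz => by
    have hz' : conj z ≠ 0 := (_root_.map_ne_zero _).2 hz
    have h1 := h.eval_den z hz
    have h2 := h.eval_num hz
    simp only [eval_add, eval_mul, eval_sub, eval_C, eval_X, eval_one, map_add, map_mul, map_sub,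
      map_one, map_div₀, Complex.conj_conj]
    rw [h1, h2, pow_succ]
    field_simp
    ring
  den_ne_zero := fun z hz => by
    have h0 := h.den_ne_zero z hz
    have h1 := one_sub_conj_mul_ne_zero ha hz
    have hs : ‖blaschkeFactor a z * (N.eval z / D.eval z)‖ ≤ 1 := by
      rw [norm_mul]
      exact mul_le_one₀ (norm_blaschkeFactor_le ha hz) (norm_nonneg _) (h.norm_le z hz)
    have h2 := one_add_conj_mul_ne_zero hγ hs
    have e : (1 - conj a * z) * D.eval z *
        (1 + conj γ * (blaschkeFactor a z * (N.eval z / D.eval z))) =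
        ((1 - C (conj a) * X) * D + C (conj γ) * (X - C a) * N).eval z := by
      have hE : (1 - conj a * z) * D.eval z ≠ 0 := mul_ne_zero h1 h0
      rw [blaschkeFactor, div_mul_div_comm, mul_add, mul_one, mul_left_comm, mul_div_cancel₀ _ hE]
      simp only [eval_add, eval_mul, eval_sub, eval_C, eval_X, eval_one]
      ring
    rw [← e]
    exact mul_ne_zero (mul_ne_zero h1 h0) h2
  norm_le := fun z hz => by
    rw [eval_step ha hz (h.den_ne_zero z hz)]
    exact norm_inverseStep_le hγ (norm_blaschkeFactor_le ha hz) (h.norm_le z hz)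

/-- Factoring `N` over its roots determines `D` off `0` by reciprocity, and everywhere by density.
Then `D 0 ≠ 0` forces exactly `n` roots, and a root `β` with `|β| ≥ 1` would give `D` the zero `1 /
conj β` in the closed disk. -/
lemma IsReciprocalQuotient.isFiniteBlaschke {n : ℕ} {N D : ℂ[X]}
    (h : IsReciprocalQuotient n N D) {f : ℂ → ℂ}
    (hf : ∀ z ∈ Metric.ball (0 : ℂ) 1, f z = N.eval z / D.eval z) : IsFiniteBlaschke f := by
  obtain ⟨L, hL⟩ := Quot.exists_rep N.roots
  have hL : (L : Multiset ℂ) = N.roots := hL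
  set c := N.leadingCoeff
  have hsplit := IsAlgClosed.splits N
  have hN : ∀ z, N.eval z = c * ∏ j : Fin L.length, (z - L[j]) := fun z => by
    conv_lhs => rw [hsplit.eq_prod_roots]
    rw [eval_mul, eval_C, eval_multiset_prod, Multiset.map_map, ← hL, Multiset.map_coe,
      Multiset.prod_coe]
    congr 1
    rw [← Fin.prod_univ_fun_getElem]
    simp
  have hlen : L.length ≤ n := by
    have h1 : L.length = Multiset.card N.roots := by rw [← hL, Multiset.coe_card]
    rw [h1, ← hsplit.natDegree_eq_card_roots]
    exact h.natDegree_num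
  have hD : ∀ z, D.eval z =
      conj c * z ^ (n - L.length) * ∏ j : Fin L.length, (1 - conj L[j] * z) := by
    have hd : Dense ({0}ᶜ : Set ℂ) := dense_compl_singleton 0
    have := Continuous.ext_on (f := fun z => D.eval z)
      (g := fun z => conj c * z ^ (n - L.length) * ∏ j : Fin L.length, (1 - conj L[j] * z))
      hd D.continuous (by fun_prop) fun z hz => by
        have hz : z ≠ 0 := hz
        have hz' : conj z ≠ 0 := (_root_.map_ne_zero _).2 hz
        beta_reduce
        rw [h.eval_den z hz, hN, map_mul, map_prod]
        have : ∏ j : Fin L.length, (1 - conj L[j] * z) =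
            z ^ L.length * ∏ j : Fin L.length, conj (1 / conj z - L[j]) := by
          have hcard : z ^ L.length = ∏ _j : Fin L.length, z := by simp
          rw [hcard, ← Finset.prod_mul_distrib]
          refine Finset.prod_congr rfl fun j _ => ?_
          rw [map_sub, map_div₀, map_one, Complex.conj_conj]
          field_simp
        rw [this, ← Nat.sub_add_cancel hlen, pow_add, Nat.add_sub_cancel]
        ring
    exact congrFun this
  have hn : n - L.length = 0 := by
    by_contra hne
    refine h.den_ne_zero 0 (by simp) ?_
    rw [hD, zero_pow hne]
    simp
  have hc : c ≠ 0 := fun hc => h.den_ne_zero 0 (by simp) (by rw [hD, hc]; simp)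
  have hβ : ∀ j : Fin L.length, ‖L[j]‖ < 1 := by
    intro j
    by_contra hj
    push Not at hj
    have h0 : L[j] ≠ 0 := norm_pos_iff.1 (one_pos.trans_le hj)
    have h0' : conj L[j] ≠ 0 := (_root_.map_ne_zero _).2 h0
    refine h.den_ne_zero (1 / conj L[j]) ?_ ?_
    · rw [norm_div, norm_one, Complex.norm_conj]
      exact div_le_one_of_le₀ hj (norm_nonneg _)
    · rw [hD, Finset.prod_eq_zero (Finset.mem_univ j), mul_zero]
      rw [mul_one_div_cancel h0', sub_self]
  refine ⟨L.length, fun j => L[j], c / conj c, hβ, ?_, fun z hz => ?_⟩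
  · rw [norm_div, Complex.norm_conj, div_self (norm_ne_zero_iff.2 hc)]
  · rw [hf z hz, hN, hD, hn, pow_zero, mul_one, Finset.prod_div_distrib, div_mul_div_comm]

lemma IsReciprocalQuotient.isFiniteBlaschke_wallMap {a γ : ℕ → ℂ} (ha : ∀ n, ‖a n‖ < 1) (k : ℕ)
    (hγ : ∀ n < k, ‖γ n‖ < 1) {n : ℕ} {N D : ℂ[X]} (h : IsReciprocalQuotient n N D) {f : ℂ → ℂ}
    (hf : ∀ z ∈ Metric.ball (0 : ℂ) 1, f z = wallMap a γ k z (N.eval z / D.eval z)) :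
    IsFiniteBlaschke f := by
  induction k generalizing n N D with
  | zero => exact h.isFiniteBlaschke hf
  | succ k ih =>
    refine ih (fun n hn => hγ n (by omega)) (h.step (ha k) (hγ k (by omega))) fun z hz => ?_
    have hz' : ‖z‖ ≤ 1 := (mem_ball_zero_iff.1 hz).le
    rw [hf z hz, wallMap, eval_step (ha k) hz' (h.den_ne_zero z hz')]

end FiniteBlaschke

/-! ### The Schur algorithm stays in the Schur class and does not terminate. -/

/-- Schwarz–Pick: the Schwarz lemma applied to `g` after disk automorphisms send `a` and `g a` to
`0`. -/
lemma IsSchur.norm_sub_div_le {g : ℂ → ℂ} (hg : IsSchur g) (hlt : ∀ z : ℂ, ‖z‖ < 1 → ‖g z‖ < 1)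
    {a : ℂ} (ha : ‖a‖ < 1) {z : ℂ} (hz : ‖z‖ < 1) :
    ‖(g z - g a) / (1 - conj (g a) * g z)‖ ≤ ‖blaschkeFactor a z‖ := by
  have hna : ‖-a‖ < 1 := by rwa [norm_neg]
  have hmaps : ∀ w ∈ Metric.ball (0 : ℂ) 1, blaschkeFactor (-a) w ∈ Metric.ball (0 : ℂ) 1 :=
    fun w hw => mem_ball_zero_iff.2 (norm_blaschkeFactor_lt hna (mem_ball_zero_iff.1 hw))
  have hd : DifferentiableOn ℂ (fun w => blaschkeFactor (g a) (g (blaschkeFactor (-a) w)))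
      (Metric.ball 0 1) :=
    (differentiableOn_blaschkeFactor (hlt a ha)).comp
      (hg.1.comp (differentiableOn_blaschkeFactor hna) hmaps)
      fun w hw => mem_ball_zero_iff.2 (hlt _ (mem_ball_zero_iff.1 (hmaps w hw)))
  have h := Complex.norm_le_norm_of_mapsTo_ball (z := blaschkeFactor a z) hd (fun w hw => by
    rw [mem_closedBall_zero_iff]
    exact norm_blaschkeFactor_le (hlt a ha) (hg.2 _ (hmaps w hw)))
    (by simp [blaschkeFactor]) (norm_blaschkeFactor_lt ha hz)
  rw [blaschkeFactor_neg_blaschkeFactor ha hz.le] at h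
  exact h

/-- Away from `a` the bound is Schwarz–Pick; at `a` it follows by continuity. -/
lemma IsSchur.schurStep {g : ℂ → ℂ} (hg : IsSchur g) (hlt : ∀ z : ℂ, ‖z‖ < 1 → ‖g z‖ < 1)
    {a : ℂ} (ha : ‖a‖ < 1) : IsSchur (schurStep a g) := by
  have hmem : Metric.ball (0 : ℂ) 1 ∈ 𝓝 a := Metric.isOpen_ball.mem_nhds (mem_ball_zero_iff.2 ha)
  have hd : DifferentiableOn ℂ (MultipointSchur.schurStep a g) (Metric.ball 0 1) := by
    have h1 : DifferentiableOn ℂ (dslope g a) (Metric.ball 0 1) :=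
      (Complex.differentiableOn_dslope hmem).2 hg.1
    refine DifferentiableOn.div (DifferentiableOn.mul (by fun_prop) h1)
      ((hg.1.const_mul _).const_sub 1) fun z hz => ?_
    exact one_sub_conj_mul_ne_zero (hlt a ha) (hg.2 z hz)
  refine ⟨hd, ?_⟩
  have hne : ∀ z : ℂ, ‖z‖ < 1 → z ≠ a → ‖MultipointSchur.schurStep a g z‖ ≤ 1 := by
    intro z hz hza
    have h0 : blaschkeFactor a z ≠ 0 :=
      div_ne_zero (sub_ne_zero.2 hza) (one_sub_conj_mul_ne_zero ha hz.le)
    rw [schurStep_of_ne a g z hza, norm_mul, norm_div, norm_one, one_div_mul_eq_div]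
    exact div_le_one_of_le₀ (hg.norm_sub_div_le hlt ha hz) (norm_nonneg _)
  intro z hz
  rcases eq_or_ne z a with rfl | hza
  · have hc : Tendsto (MultipointSchur.schurStep z g) (𝓝[≠] z)
        (𝓝 (MultipointSchur.schurStep z g z)) :=
      ((hd.continuousOn.continuousAt hmem).tendsto).mono_left nhdsWithin_le_nhds
    refine le_of_tendsto hc.norm ?_
    filter_upwards [self_mem_nhdsWithin, nhdsWithin_le_nhds hmem] with w hw hw'
    exact hne w (mem_ball_zero_iff.1 hw') hw
  · exact hne z (mem_ball_zero_iff.1 hz) hza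

lemma inverseStep_schurStep {g : ℂ → ℂ} {a z : ℂ} (ha : ‖a‖ < 1) (hz : ‖z‖ < 1)
    (hga : ‖g a‖ < 1) (hgz : ‖g z‖ ≤ 1) :
    inverseStep (g a) (blaschkeFactor a z) (schurStep a g z) = g z := by
  rcases eq_or_ne z a with rfl | hza
  · simp [inverseStep]
  have h0 : blaschkeFactor a z ≠ 0 :=
    div_ne_zero (sub_ne_zero.2 hza) (one_sub_conj_mul_ne_zero ha hz.le)
  have h1 : blaschkeFactor a z * schurStep a g z = blaschkeFactor (g a) (g z) := by
    rw [schurStep_of_ne a g z hza]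
    change blaschkeFactor a z * (1 / blaschkeFactor a z * blaschkeFactor (g a) (g z)) = _
    rw [← mul_assoc, mul_one_div_cancel h0, one_mul]
  have h2 := blaschkeFactor_neg_blaschkeFactor hga hgz
  rw [blaschkeFactor, map_neg, neg_mul, sub_neg_eq_add, sub_neg_eq_add, add_comm] at h2
  rw [inverseStep, h1, h2]

/-- A Schur function attaining modulus one is constant. -/
lemma IsSchur.eq_const {g : ℂ → ℂ} (hg : IsSchur g) {z₀ : ℂ} (hz₀ : ‖z₀‖ < 1) (h : 1 ≤ ‖g z₀‖) :
    ∀ z ∈ Metric.ball (0 : ℂ) 1, g z = g z₀ := by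
  refine Complex.eqOn_of_isPreconnected_of_isMaxOn_norm (convex_ball 0 1).isPreconnected
    Metric.isOpen_ball hg.1 (mem_ball_zero_iff.2 hz₀) fun z hz => ?_
  exact (hg.2 z hz).trans h

/-- The Schur parameters of `f`. -/
noncomputable def schurParameter (α : ℕ → ℂ) (f : ℂ → ℂ) (k : ℕ) : ℂ :=
  schurRemainder α f k (α (k + 1))

section Remainder

variable {α : ℕ → ℂ} (hα : ∀ k, ‖α k‖ < 1) {f : ℂ → ℂ}
include hα

/-- Only the remainders before `k` are assumed to be strict Schur functions, so that this can be
used inside the induction proving that all of them are. -/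
lemma wallMap_schurRemainder_of_lt (k : ℕ)
    (h : ∀ n < k, IsSchur (schurRemainder α f n) ∧
      ∀ z : ℂ, ‖z‖ < 1 → ‖schurRemainder α f n z‖ < 1) {z : ℂ} (hz : ‖z‖ < 1) :
    wallMap (fun n => α (n + 1)) (schurParameter α f) k z (schurRemainder α f k z) = f z := by
  induction k with
  | zero => rfl
  | succ k ih =>
    rw [← ih fun n hn => h n (by omega)]
    have hk := (h k (by omega)).2
    exact congrArg _ (inverseStep_schurStep (hα (k + 1)) hz (hk _ (hα (k + 1))) (hk z hz).le)

/-- A remainder attaining modulus one is a unimodular constant by the maximum principle; undoing the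
earlier steps would then exhibit `f` as a finite Blaschke product. -/
lemma isSchur_schurRemainder (hf : IsSchur f) (hB : ¬ IsFiniteBlaschke f) (k : ℕ) :
    IsSchur (schurRemainder α f k) ∧ ∀ z : ℂ, ‖z‖ < 1 → ‖schurRemainder α f k z‖ < 1 := by
  induction k using Nat.strong_induction_on with
  | _ k ih =>
    have h1 : IsSchur (schurRemainder α f k) := by
      rcases k with _ | k
      · exact hf
      · exact (ih k (by omega)).1.schurStep (ih k (by omega)).2 (hα (k + 1))
    refine ⟨h1, fun z hz => ?_⟩
    by_contra hlt
    push Not at hlt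
    have hc : ‖schurRemainder α f k z‖ = 1 :=
      le_antisymm (h1.2 z (mem_ball_zero_iff.2 hz)) hlt
    -- A degree-zero reciprocal quotient has the form `c / conj c`, which is `c ^ 2` for unimodular
    -- `c`; hence the square root.
    obtain ⟨c, hc2⟩ := IsAlgClosed.exists_pow_nat_eq (schurRemainder α f k z) zero_lt_two
    have hc1 : ‖c‖ = 1 := by
      rw [← hc2, norm_pow] at hc
      exact (pow_eq_one_iff_of_nonneg (norm_nonneg _) two_ne_zero).1 hc
    have hc3 : c / conj c = schurRemainder α f k z := by
      have hne : conj c ≠ 0 := by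
        rw [← norm_ne_zero_iff, Complex.norm_conj, hc1]
        exact one_ne_zero
      have hmul : c * conj c = 1 := by
        rw [Complex.mul_conj, Complex.normSq_eq_norm_sq, hc1]
        simp
      rw [div_eq_iff hne, ← hc2, sq, mul_assoc, hmul, mul_one]
    refine hB ((isReciprocalQuotient_const hc1).isFiniteBlaschke_wallMap (a := fun n => α (n + 1))
      (γ := schurParameter α f) (fun n => hα (n + 1)) k
      (fun n hn => (ih n hn).2 _ (hα (n + 1))) fun w hw => ?_)
    rw [← wallMap_schurRemainder_of_lt hα k ih (mem_ball_zero_iff.1 hw), Polynomial.eval_C,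
      Polynomial.eval_C, hc3, h1.eq_const hz hlt w hw]

end Remainder


/-! ### The Herglotz measure and its density. -/

section Herglotz

variable {f : ℂ → ℂ} {μ : Measure Circle} [IsProbabilityMeasure μ]

lemma IsHerglotzMeasure.integral_poisson (hμ : IsHerglotzMeasure f μ) {b : ℂ} (hb : ‖b‖ < 1) :
    ∫ t, poisson t b ∂μ = ((1 + b * f b) / (1 - b * f b)).re := by
  have hc : Continuous fun t : Circle => ((t : ℂ) + b) / ((t : ℂ) - b) :=
    Continuous.div (by fun_prop) (by fun_prop) fun t => circle_sub_ne_zero hb t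
  rw [hμ b (mem_ball_zero_iff.2 hb)]
  refine Eq.trans ?_ (integral_re (𝕜 := ℂ) (integrable_of_continuous hc μ))
  exact integral_congr_ae (Eventually.of_forall fun t => poisson_eq_re t)

variable {w : Circle → ℝ} (hw : w =ᵐ[m] fun t => (μ.rnDeriv m t).toReal)
include hw

lemma integrable_density : Integrable w m :=
  (Measure.integrable_toReal_rnDeriv (μ := μ)).congr hw.symm

omit [IsProbabilityMeasure μ] in
lemma ae_density_nonneg : ∀ᵐ t ∂m, 0 ≤ w t := by
  filter_upwards [hw] with t ht
  rw [ht]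
  exact ENNReal.toReal_nonneg

lemma integral_poisson_eq_add {b : ℂ} (hb : ‖b‖ < 1) :
    ∫ t, poisson t b ∂μ =
      ∫ t, w t * poisson t b ∂m + ∫ t, poisson t b ∂(μ.singularPart m) := by
  have hP := continuous_poisson hb
  conv_lhs => rw [μ.haveLebesgueDecomposition_add m]
  rw [integral_add_measure (integrable_of_continuous hP _) (integrable_of_continuous hP _),
    integral_withDensity_eq_integral_toReal_smul (Measure.measurable_rnDeriv _ _)
      (Measure.rnDeriv_lt_top _ _), add_comm]
  congr 1
  refine integral_congr_ae ?_
  filter_upwards [hw] with t ht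
  rw [ht, smul_eq_mul]

lemma integral_density_mul_poisson_le {b : ℂ} (hb : ‖b‖ < 1) :
    ∫ t, w t * poisson t b ∂m ≤ ∫ t, poisson t b ∂μ := by
  rw [integral_poisson_eq_add hw hb]
  exact le_add_of_nonneg_right (integral_nonneg fun t => poisson_nonneg hb t)

omit hw

lemma IsSchur.mul_schur {f : ℂ → ℂ} (hf : IsSchur f) {G : ℂ → ℂ} (hG : IsSchur G) :
    IsSchur fun z => G z * f z :=
  ⟨hG.1.mul hf.1, fun z hz => by
    rw [norm_mul]
    exact mul_le_one₀ (hG.2 z hz) (norm_nonneg _) (hf.2 z hz)⟩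

lemma trace_mul {f G : ℂ → ℂ} {t : Circle} (hf : Tendsto f (nontangential t) (𝓝 (trace f t)))
    (hG : Tendsto G (𝓝[Metric.ball 0 1] (t : ℂ)) (𝓝 (G t))) :
    trace (fun z => G z * f z) t = G t * trace f t :=
  ((hG.mono_left (nontangential_le t)).mul hf).limUnder_eq

include hw

/-- The density of the Herglotz measure is dominated by the boundary values of the real part of
the Herglotz function. -/
lemma ae_density_le (hf : IsSchur f) (hμ : IsHerglotzMeasure f μ) :
    ∀ᵐ t : Circle ∂m, w t ≤ (1 - ‖trace f t‖ ^ 2) / ‖1 - t * trace f t‖ ^ 2 := by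
  have hid : IsSchur fun z => z := ⟨differentiableOn_id, fun z hz => (mem_ball_zero_iff.1 hz).le⟩
  have hF := hf.mul_schur hid
  have hlt : ∀ z : ℂ, ‖z‖ < 1 → ‖z * f z‖ < 1 := fun z hz => by
    rw [norm_mul]
    exact mul_lt_one_of_nonneg_of_lt_one_left (norm_nonneg _) hz (hf.2 z (mem_ball_zero_iff.2 hz))
  have hwi := integrable_density hw
  filter_upwards [ae_trace_ne_one hF hlt, hf.fatou.1, ae_tendsto_integral_ball_div hwi]
    with t ht htr hL
  have hid' : Tendsto (fun z : ℂ => z) (𝓝[Metric.ball 0 1] (t : ℂ)) (𝓝 (t : ℂ)) :=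
    tendsto_id.mono_left nhdsWithin_le_nhds
  rw [trace_mul (G := fun z => z) htr hid'] at ht
  have h1 : Tendsto (fun z => z * f z) (nontangential t) (𝓝 (t * trace f t)) :=
    (hid'.mono_left (nontangential_le t)).mul htr
  have h2 := (Complex.continuous_re.tendsto _).comp
    ((h1.const_add 1).div (h1.const_sub 1) (sub_ne_zero.2 ht.symm))
  have h3 := tendsto_integral_poisson_smul hwi hL
  have h4 := le_of_tendsto_of_tendsto h3 h2 (by
    filter_upwards [eventually_nontangential t] with z hz
    change _ ≤ ((1 + z * f z) / (1 - z * f z)).re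
    rw [← hμ.integral_poisson hz]
    refine le_trans (le_of_eq ?_) (integral_density_mul_poisson_le hw hz)
    simp only [smul_eq_mul, mul_comm])
  rwa [re_cayley, norm_mul, Circle.norm_coe, one_mul] at h4

end Herglotz

/-! ### Pointwise inequalities behind the main estimate. -/

lemma one_sub_le_of_sqrt {p η : ℝ} (hp : 0 ≤ p) (hη : 0 < η) :
    1 - p ≤ η + (1 / η) * (1 - Real.sqrt p) ^ 2 := by
  have hs := Real.sqrt_nonneg p
  have hs2 := Real.sq_sqrt hp
  generalize Real.sqrt p = s at hs hs2
  have h1 : 2 * (1 - s) ≤ η + (1 / η) * (1 - s) ^ 2 := by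
    have h : 0 ≤ (1 / η) * (η - (1 - s)) ^ 2 := by positivity
    have e : (1 / η) * (η - (1 - s)) ^ 2 = η + (1 / η) * (1 - s) ^ 2 - 2 * (1 - s) := by
      field_simp; ring
    linarith
  nlinarith [sq_nonneg (1 - s)]

/-- The difference of the two sides is a sum of two nonnegative square terms, both zero at `w = ρ⁻¹
= c`. The lower bound is linear in `√w`, `w` and `ρ⁻¹`, so it can be averaged. -/
lemma le_sqrt_mul {w ρ c : ℝ} (hw : 0 ≤ w) (hρ : 0 < ρ) (hc : 0 < c) :
    2 * (Real.sqrt w / Real.sqrt c) - (w + ρ⁻¹) / (2 * c) ≤ Real.sqrt (w * ρ) := by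
  rw [Real.sqrt_mul hw]
  have hy := Real.sqrt_nonneg w
  have hy2 := Real.sq_sqrt hw
  have hq := Real.sqrt_pos.2 hρ
  have hq2 := Real.sq_sqrt hρ.le
  have hk := Real.sqrt_pos.2 hc
  have hk2 := Real.sq_sqrt hc.le
  generalize Real.sqrt w = y at hy hy2
  generalize Real.sqrt ρ = q at hq hq2
  generalize Real.sqrt c = k at hk hk2
  subst hy2 hq2 hk2
  have e : y * q - (2 * (y / k) - (y ^ 2 + (q ^ 2)⁻¹) / (2 * k ^ 2)) =
      y * q * (1 - 1 / (k * q)) ^ 2 + (y / k - 1 / (k * q)) ^ 2 / 2 := by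
    field_simp
    ring
  have : 0 ≤ y * q * (1 - 1 / (k * q)) ^ 2 := by positivity
  nlinarith [sq_nonneg (y / k - 1 / (k * q))]

lemma norm_sq_le_of_density_le {g : ℂ} {w ρ c η : ℝ} (hg : ‖g‖ ≤ 1) (hw : 0 ≤ w) (hρ : 0 < ρ)
    (hc : 0 < c) (hη : 0 < η) (h : w * ρ * ‖1 - g‖ ^ 2 ≤ 1 - ‖g‖ ^ 2) :
    ‖g‖ ^ 2 ≤ g.re + 2 * η +
      (2 / η) * (1 + w * ρ - 4 * (Real.sqrt w / Real.sqrt c) + (w + ρ⁻¹) / c) := by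
  have hp : 0 ≤ w * ρ := by positivity
  have h1 := one_sub_le_of_sqrt hp hη
  have h2 := le_sqrt_mul hw hρ hc
  set K := η + (1 / η) * (1 - Real.sqrt (w * ρ)) ^ 2 with hK
  have hK0 : 0 ≤ K := by positivity
  have hn : ‖1 - g‖ ^ 2 = 1 - 2 * g.re + ‖g‖ ^ 2 := by
    simp only [← Complex.normSq_eq_norm_sq, Complex.normSq_apply, Complex.sub_re, Complex.sub_im,
      Complex.one_re, Complex.one_im]
    ring
  have hn4 : ‖1 - g‖ ^ 2 ≤ 4 := by
    have := norm_sub_le 1 g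
    rw [norm_one] at this
    nlinarith [norm_nonneg (1 - g)]
  -- From `1 - w ρ ≤ K` one gets `(1 - K) |1 - g|² ≤ 1 - |g|²`; expand `|1 - g|²` and use `|1 - g|²
  -- ≤ 4`.
  have h3 : ‖g‖ ^ 2 ≤ g.re + 2 * K := by nlinarith [sq_nonneg ‖1 - g‖]
  have h4 : 2 * K ≤ 2 * η + (2 / η) *
      (1 + w * ρ - 4 * (Real.sqrt w / Real.sqrt c) + (w + ρ⁻¹) / c) := by
    have h5 : (1 - Real.sqrt (w * ρ)) ^ 2 ≤
        1 + w * ρ - 4 * (Real.sqrt w / Real.sqrt c) + (w + ρ⁻¹) / c := by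
      have e : (w + ρ⁻¹) / c = 2 * ((w + ρ⁻¹) / (2 * c)) := by field_simp
      rw [e]
      nlinarith [Real.sq_sqrt hp]
    have h6 := mul_le_mul_of_nonneg_left h5 (by positivity : 0 ≤ 2 / η)
    have e : 2 * K = 2 * η + 2 / η * (1 - Real.sqrt (w * ρ)) ^ 2 := by rw [hK]; ring
    rw [e]
    linarith
  linarith

lemma integrable_sqrt {w : Circle → ℝ} (hw : Integrable w m) :
    Integrable (fun t => Real.sqrt (w t)) m := by
  refine Integrable.mono' (hw.abs.add (integrable_const 1))
    (Real.continuous_sqrt.comp_aestronglyMeasurable hw.1) (Eventually.of_forall fun t => ?_)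
  rw [Real.norm_of_nonneg (Real.sqrt_nonneg _), Pi.add_apply]
  refine Real.sqrt_le_iff.2 ⟨by positivity, ?_⟩
  nlinarith [abs_nonneg (w t), le_abs_self (w t)]

/-! ### The main estimate for the remainders. -/

section Remainder

variable {α : ℕ → ℂ} (hα : ∀ k, ‖α k‖ < 1) {f : ℂ → ℂ} (hf : IsSchur f)
  (hB : ¬ IsFiniteBlaschke f)
include hα hf hB

lemma integrable_remainderIntegrand (k : ℕ) : Integrable (remainderIntegrand α f k) m := by
  have hk := (isSchur_schurRemainder hα hf hB k).1
  refine integrable_mul_poisson ?_ (hα k)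
  refine Integrable.mono' (integrable_const (1 : ℝ)) (hk.fatou.2.1.1.norm.pow 2) ?_
  filter_upwards [hk.fatou.1] with t ht
  have := hk.norm_trace_le ht
  rw [Real.norm_of_nonneg (by positivity)]
  exact pow_le_one₀ (norm_nonneg _) this

variable {μ : Measure Circle} [IsProbabilityMeasure μ] (hμ : IsHerglotzMeasure f μ)
  {w : Circle → ℝ} (hw : w =ᵐ[m] fun t => (μ.rnDeriv m t).toReal)
include hμ hw

/-- The main estimate. -/
theorem integral_remainderIntegrand_le (k : ℕ) {c η : ℝ} (hc : 0 < c) (hη : 0 < η) :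
    ∫ t, remainderIntegrand α f (k + 1) t ∂m ≤ 2 * η + (2 / η) *
      (2 - 4 * ((∫ t, Real.sqrt (w t) * poisson t (α (k + 1)) ∂m) / Real.sqrt c) +
        ((∫ t, w t * poisson t (α (k + 1)) ∂m) + ∫ t, poisson t (α (k + 1)) ∂μ) / c) := by
  set n := k + 1 with hn
  set a : ℕ → ℂ := fun n => α (n + 1) with ha_def
  set γ := schurParameter α f
  have ha : ∀ n, ‖a n‖ < 1 := fun n => hα (n + 1)
  have hS := isSchur_schurRemainder hα hf hB
  have hγ : ∀ n, ‖γ n‖ < 1 := fun n => (hS n).2 _ (ha n)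
  have hb := hα n
  set b := α n with hb_def
  have hfn := (hS n).1
  set fn := schurRemainder α f n
  set G := inverseIterate a γ n
  set ρ : Circle → ℝ := fun t => wallWeight a γ n t with hρ_def
  have hρ : ∀ t, 0 < ρ t := fun t => wallWeight_pos ha hγ n (Circle.norm_coe t).le
  have hρc : Continuous ρ := continuous_wallWeight ha hγ n
  have hGS : IsSchur G := ⟨differentiableOn_inverseIterate ha hγ n, fun z hz =>
    norm_inverseIterate_le ha hγ n (mem_ball_zero_iff.1 hz).le⟩
  have hg := hfn.mul_schur hGS
  set g : ℂ → ℂ := fun z => G z * fn z with hg_def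
  have hglt : ∀ z : ℂ, ‖z‖ < 1 → ‖g z‖ < 1 := fun z hz => by
    rw [hg_def, norm_mul]
    exact mul_lt_one_of_nonneg_of_lt_one_right (hGS.2 z (mem_ball_zero_iff.2 hz)) (norm_nonneg _)
      ((hS n).2 z hz)
  -- The last Blaschke factor in `G` is the one at `a k = α (k + 1) = b`.
  have hgb : g b = 0 := by
    have : blaschkeFactor (a k) b = 0 := blaschkeFactor_self _
    simp only [hg_def, G, hn, inverseIterate, this, zero_mul]
  have hwi := integrable_density hw
  have htrace : ∀ᵐ t : Circle ∂m, trace g t = G t * trace fn t ∧ ‖trace g t‖ = ‖trace fn t‖ ∧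
      ‖trace g t‖ ≤ 1 ∧ 0 ≤ w t ∧
      w t * ρ t ≤ (1 - ‖trace g t‖ ^ 2) / ‖1 - trace g t‖ ^ 2 ∧
      w t * ρ t * ‖1 - trace g t‖ ^ 2 ≤ 1 - ‖trace g t‖ ^ 2 := by
    filter_upwards [hfn.fatou.1, hf.fatou.1, ae_density_le hw hf hμ, ae_trace_ne_one hg hglt,
      ae_density_nonneg hw] with t h1 h2 h3 h4 h5
    have e1 : trace g t = G t * trace fn t := trace_mul h1
      (tendsto_inverseIterate ha hγ n (Circle.norm_coe t).le
        (tendsto_id.mono_left nhdsWithin_le_nhds))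
    have hfn1 := hfn.norm_trace_le h1
    have e2 : ‖trace g t‖ = ‖trace fn t‖ := by
      rw [e1, norm_mul, norm_inverseIterate_eq ha hγ n (Circle.norm_coe t), one_mul]
    have e3 : trace f t = wallMap a γ n t (trace fn t) := by
      have h6 := tendsto_wallMap ha hγ n (Circle.norm_coe t).le hfn1
        (tendsto_id.mono_left ((nontangential_le t).trans nhdsWithin_le_nhds)) h1
      refine tendsto_nhds_unique h2 (h6.congr' ?_)
      filter_upwards [eventually_nontangential t] with z hz
      exact wallMap_schurRemainder_of_lt hα n (fun n _ => hS n) hz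
    have h7 : w t * ρ t ≤ (1 - ‖trace g t‖ ^ 2) / ‖1 - trace g t‖ ^ 2 := by
      rw [e2, e1, ← density_wallMap_mul_wallWeight ha hγ n (Circle.norm_coe t) hfn1, ← e3]
      exact mul_le_mul_of_nonneg_right h3 (hρ t).le
    have h8 : 0 < ‖1 - trace g t‖ := norm_pos_iff.2 (sub_ne_zero.2 h4.symm)
    exact ⟨e1, e2, e2.le.trans hfn1, h5, h7, (le_div_iff₀ (by positivity)).1 h7⟩
  have hpi : Integrable (fun t => w t * ρ t) m := by
    obtain ⟨C, hC⟩ := (isCompact_univ (X := Circle)).exists_bound_of_continuousOn hρc.continuousOn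
    exact hwi.mul_bdd (c := C) hρc.aestronglyMeasurable (Eventually.of_forall fun t => hC t trivial)
  have hρi : Integrable (fun t => (ρ t)⁻¹) m :=
    integrable_of_continuous (hρc.inv₀ fun t => (hρ t).ne') m
  -- The dominating function `Re ((1 + g) / (1 - g))` has Poisson average at most its value at `b`,
  -- which is `1` because `g b = 0`.
  have hI1 : ∫ t, (w t * ρ t) * poisson t b ∂m ≤ 1 := by
    rw [integral_eq_lintegral_of_nonneg_ae _ (integrable_mul_poisson hpi hb).1]
    · refine ENNReal.toReal_le_of_le_ofReal zero_le_one ?_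
      refine le_trans (lintegral_mono_ae ?_) ((lintegral_trace_cayley_le hg hglt hb).trans ?_)
      · filter_upwards [htrace] with t ht
        exact ENNReal.ofReal_le_ofReal
          (mul_le_mul_of_nonneg_right ht.2.2.2.2.1 (poisson_nonneg hb t))
      · rw [hgb]; simp
    · filter_upwards [htrace] with t ht
      exact mul_nonneg (mul_nonneg ht.2.2.2.1 (hρ t).le) (poisson_nonneg hb t)
  -- At `b` the last inverse step has `s = 0` and forgets its argument, so putting `0` in place of
  -- the remainder still yields `f b`.
  have hI2 : ∫ t, (ρ t)⁻¹ * poisson t b ∂m = ∫ t, poisson t b ∂μ := by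
    rw [hμ.integral_poisson hb, integral_inv_wallWeight ha hγ n hb]
    have : wallMap a γ n b 0 = f b := by
      rw [← wallMap_schurRemainder_of_lt hα n (fun n _ => hS n) hb]
      have : blaschkeFactor (a k) b = 0 := blaschkeFactor_self _
      simp only [hn, wallMap]
      change wallMap a γ k b (inverseStep (γ k) (blaschkeFactor (a k) b) 0) =
        wallMap a γ k b (inverseStep (γ k) (blaschkeFactor (a k) b) _)
      rw [this, inverseStep, inverseStep, zero_mul, zero_mul]
    rw [this]
  have hgre : Integrable (fun t => (trace g t).re) m := hg.fatou.2.1.re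
  have hI3 : ∫ t, (trace g t).re * poisson t b ∂m = 0 := by
    have h1 := hg.fatou.2.2 b hb
    have h2 := integral_re (𝕜 := ℂ) (integrable_poisson_smul hg.fatou.2.1 hb)
    rw [h1, hgb] at h2
    rw [map_zero] at h2
    rw [← h2]
    refine integral_congr_ae (Eventually.of_forall fun t => ?_)
    simp [mul_comm]
  have i1 := integrable_mul_poisson hgre hb
  have i2 := integrable_mul_poisson hpi hb
  have i3 := integrable_mul_poisson (integrable_sqrt hwi) hb
  have i4 := integrable_mul_poisson hwi hb
  have i5 := integrable_mul_poisson hρi hb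
  have i0 := integrable_of_continuous (continuous_poisson hb) m
  have hle : ∫ t, remainderIntegrand α f n t ∂m ≤ ∫ t, ((trace g t).re * poisson t b +
      (2 * η + 2 / η) * poisson t b + (2 / η) * (w t * ρ t * poisson t b) -
      (2 / η * (4 / Real.sqrt c)) * (Real.sqrt (w t) * poisson t b) +
      (2 / η / c) * (w t * poisson t b) + (2 / η / c) * ((ρ t)⁻¹ * poisson t b)) ∂m := by
    refine integral_mono_ae (integrable_remainderIntegrand hα hf hB n)
      (((((i1.add (i0.const_mul _)).add (i2.const_mul _)).sub (i3.const_mul _)).add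
        (i4.const_mul _)).add (i5.const_mul _)) ?_
    filter_upwards [htrace] with t ht
    obtain ⟨-, e2, h1, h5, -, h8⟩ := ht
    have := mul_le_mul_of_nonneg_right (norm_sq_le_of_density_le h1 h5 (hρ t) hc hη h8)
      (poisson_nonneg hb t)
    rw [e2] at this
    refine this.trans (le_of_eq ?_)
    ring
  refine hle.trans ?_
  have j1 : Integrable (fun t => (trace g t).re * poisson t b +
      (2 * η + 2 / η) * poisson t b) m := i1.add (i0.const_mul _)
  have j2 : Integrable (fun t => (trace g t).re * poisson t b + (2 * η + 2 / η) * poisson t b +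
      (2 / η) * (w t * ρ t * poisson t b)) m := j1.add (i2.const_mul _)
  have j3 : Integrable (fun t => (trace g t).re * poisson t b + (2 * η + 2 / η) * poisson t b +
      (2 / η) * (w t * ρ t * poisson t b) -
      (2 / η * (4 / Real.sqrt c)) * (Real.sqrt (w t) * poisson t b)) m := j2.sub (i3.const_mul _)
  have j4 : Integrable (fun t => (trace g t).re * poisson t b + (2 * η + 2 / η) * poisson t b +
      (2 / η) * (w t * ρ t * poisson t b) -
      (2 / η * (4 / Real.sqrt c)) * (Real.sqrt (w t) * poisson t b) +
      (2 / η / c) * (w t * poisson t b)) m := j3.add (i4.const_mul _)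
  rw [integral_add j4 (i5.const_mul _), integral_add j3 (i4.const_mul _),
    integral_sub j2 (i3.const_mul _), integral_add j1 (i2.const_mul _),
    integral_add i1 (i0.const_mul _)]
  simp only [integral_const_mul]
  rw [hI2, hI3, integral_poisson hb]
  have h9 := mul_le_mul_of_nonneg_left hI1 (by positivity : 0 ≤ 2 / η)
  calc _ ≤ 0 + (2 * η + 2 / η) * 1 + 2 / η * 1 -
        (2 / η * (4 / Real.sqrt c)) * (∫ t, Real.sqrt (w t) * poisson t b ∂m) +
        (2 / η / c) * (∫ t, w t * poisson t b ∂m) + (2 / η / c) * ∫ t, poisson t b ∂μ := by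
        gcongr
    _ = _ := by ring

end Remainder


/-! ### Unrestricted boundary limits of Poisson integrals. -/

lemma poisson_le_of_dist_le {ξ t : Circle} {δ : ℝ} (hδ : 0 < δ) (ht : δ ≤ dist t ξ) {z : ℂ}
    (hz : ‖z‖ < 1) (hzξ : ‖z - ξ‖ < δ / 2) :
    poisson t z ≤ (1 - ‖z‖ ^ 2) * (4 / δ ^ 2) := by
  have h1 : dist t ξ = ‖(t : ℂ) - ξ‖ := by rw [← dist_eq_norm]; rfl
  have h2 := norm_sub_le_norm_sub_add_norm_sub (t : ℂ) z ξ
  have h3 : δ / 2 ≤ ‖(t : ℂ) - z‖ := by linarith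
  have h4 := (one_sub_norm_sq_pos hz).le
  calc poisson t z ≤ (1 - ‖z‖ ^ 2) / (δ / 2) ^ 2 := by unfold poisson; gcongr
    _ = _ := by field_simp; norm_num

lemma tendsto_one_sub_norm_sq (ξ : Circle) (C : ℝ) :
    Tendsto (fun z : ℂ => (1 - ‖z‖ ^ 2) * C) (𝓝[Metric.ball 0 1] (ξ : ℂ)) (𝓝 0) := by
  have : Tendsto (fun z : ℂ => (1 - ‖z‖ ^ 2) * C) (𝓝 (ξ : ℂ)) (𝓝 ((1 - ‖(ξ : ℂ)‖ ^ 2) * C)) :=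
    Continuous.tendsto (by fun_prop) _
  rw [Circle.norm_coe, one_pow, sub_self, zero_mul] at this
  exact this.mono_left nhdsWithin_le_nhds

lemma eventually_near (ξ : Circle) {δ : ℝ} (hδ : 0 < δ) :
    ∀ᶠ z : ℂ in 𝓝[Metric.ball 0 1] (ξ : ℂ), ‖z‖ < 1 ∧ ‖z - ξ‖ < δ := by
  filter_upwards [self_mem_nhdsWithin, nhdsWithin_le_nhds (Metric.ball_mem_nhds (ξ : ℂ) hδ)]
    with z hz hz'
  exact ⟨mem_ball_zero_iff.1 hz, by rwa [← dist_eq_norm]⟩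

/-- The Poisson integral of a measure vanishes at the boundary off its support. -/
lemma tendsto_integral_poisson_of_notMem_support {ν : Measure Circle} [IsFiniteMeasure ν]
    {ξ : Circle} (hξ : ξ ∉ ν.support) :
    Tendsto (fun z => ∫ t, poisson t z ∂ν) (𝓝[Metric.ball 0 1] (ξ : ℂ)) (𝓝 0) := by
  obtain ⟨U, hU, hνU⟩ := Measure.notMem_support_iff_exists.1 hξ
  obtain ⟨δ, hδ, hδU⟩ := Metric.mem_nhds_iff.1 hU
  have hae : ∀ᵐ t ∂ν, δ ≤ dist t ξ := by
    have : ν (Metric.ball ξ δ) = 0 := measure_mono_null hδU hνU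
    filter_upwards [measure_eq_zero_iff_ae_notMem.1 this] with t ht
    simpa using ht
  refine squeeze_zero' ?_ ?_ (tendsto_one_sub_norm_sq ξ (4 / δ ^ 2 * ν.real Set.univ))
  · filter_upwards [eventually_near ξ hδ] with z hz
    exact integral_nonneg fun t => poisson_nonneg hz.1 t
  · filter_upwards [eventually_near ξ (half_pos hδ)] with z hz
    calc ∫ t, poisson t z ∂ν ≤ ∫ _, (1 - ‖z‖ ^ 2) * (4 / δ ^ 2) ∂ν := by
          refine integral_mono_ae (integrable_of_continuous (continuous_poisson hz.1) ν)
            (integrable_const _) ?_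
          filter_upwards [hae] with t ht using poisson_le_of_dist_le hδ ht hz.1 hz.2
      _ = _ := by rw [integral_const, smul_eq_mul]; ring

/-- Poisson integrals converge unrestrictedly at points of continuity. -/
lemma tendsto_integral_mul_poisson_of_continuousAt {w : Circle → ℝ} (hw : Integrable w m)
    {ξ : Circle} (hc : ContinuousAt w ξ) :
    Tendsto (fun z => ∫ t, |w t - w ξ| * poisson t z ∂m) (𝓝[Metric.ball 0 1] (ξ : ℂ)) (𝓝 0) := by
  have hi : Integrable (fun t => |w t - w ξ|) m := (hw.sub (integrable_const _)).abs
  rw [Metric.tendsto_nhds]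
  intro ε hε
  obtain ⟨δ, hδ, hδw⟩ := Metric.continuousAt_iff.1 hc (ε / 2) (half_pos hε)
  filter_upwards [eventually_near ξ (half_pos hδ), (tendsto_one_sub_norm_sq ξ
    (4 / δ ^ 2 * ∫ t, |w t - w ξ| ∂m)).eventually (gt_mem_nhds (half_pos hε))] with z hz hz'
  have h0 : 0 ≤ ∫ t, |w t - w ξ| * poisson t z ∂m :=
    integral_nonneg fun t => mul_nonneg (abs_nonneg _) (poisson_nonneg hz.1 t)
  have hP := integrable_of_continuous (continuous_poisson hz.1) m
  have hle : ∫ t, |w t - w ξ| * poisson t z ∂m ≤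
      ∫ t, (ε / 2 * poisson t z + (1 - ‖z‖ ^ 2) * (4 / δ ^ 2) * |w t - w ξ|) ∂m := by
    refine integral_mono (integrable_mul_poisson hi hz.1)
      ((hP.const_mul _).add (hi.const_mul _)) fun t => ?_
    have hp := poisson_nonneg hz.1 t
    have hq := (one_sub_norm_sq_pos hz.1).le
    beta_reduce
    rcases lt_or_ge (dist t ξ) δ with h | h
    · have := hδw h
      rw [Real.dist_eq] at this
      have h1 := mul_le_mul_of_nonneg_right this.le hp
      have : 0 ≤ (1 - ‖z‖ ^ 2) * (4 / δ ^ 2) * |w t - w ξ| := by positivity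
      linarith
    · have h1 := mul_le_mul_of_nonneg_left (poisson_le_of_dist_le hδ h hz.1 hz.2)
        (abs_nonneg (w t - w ξ))
      have : 0 ≤ ε / 2 * poisson t z := by positivity
      linarith
  rw [integral_add (hP.const_mul _) (hi.const_mul _), integral_const_mul, integral_const_mul,
    integral_poisson hz.1, mul_assoc (1 - ‖z‖ ^ 2)] at hle
  rw [Real.dist_eq, sub_zero, abs_of_nonneg h0]
  linarith

lemma tendsto_integral_mul_poisson_of_abs {w : Circle → ℝ} (hw : Integrable w m) {c : ℝ}
    {β : ℕ → ℂ} (hβ : ∀ j, ‖β j‖ < 1)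
    (h : Tendsto (fun j => ∫ t, |w t - c| * poisson t (β j) ∂m) atTop (𝓝 0)) :
    Tendsto (fun j => ∫ t, w t * poisson t (β j) ∂m) atTop (𝓝 c) := by
  refine tendsto_iff_norm_sub_tendsto_zero.2 (squeeze_zero (fun _ => norm_nonneg _)
    (fun j => ?_) h)
  have := norm_integral_poisson_sub_le hw (hβ j) c
  simpa only [smul_eq_mul, mul_comm (poisson _ _), Real.norm_eq_abs] using this

/-! ### Passage to the limit along subsequences. -/

section Limit

variable {α : ℕ → ℂ} (hα : ∀ k, ‖α k‖ < 1) (hlim : Tendsto (fun k => ‖α k‖) atTop (𝓝 1))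
  {f : ℂ → ℂ} (hf : IsSchur f) (hB : ¬ IsFiniteBlaschke f)
  {μ : Measure Circle} [IsProbabilityMeasure μ] (hμ : IsHerglotzMeasure f μ)
  {w : Circle → ℝ} (hw : w =ᵐ[m] fun t => (μ.rnDeriv m t).toReal)
include hα hf hB hμ hw

lemma tendsto_integral_remainderIntegrand_comp {φ : ℕ → ℕ} (hφ : Tendsto φ atTop atTop) {c : ℝ}
    (hc : 0 < c)
    (hV : Tendsto (fun j => ∫ t, Real.sqrt (w t) * poisson t (α (φ j)) ∂m) atTop
      (𝓝 (Real.sqrt c)))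
    (hW : Tendsto (fun j => ∫ t, w t * poisson t (α (φ j)) ∂m) atTop (𝓝 c))
    (hM : Tendsto (fun j => ∫ t, poisson t (α (φ j)) ∂μ) atTop (𝓝 c)) :
    Tendsto (fun j => ∫ t, remainderIntegrand α f (φ j) t ∂m) atTop (𝓝 0) := by
  rw [Metric.tendsto_nhds]
  intro ε hε
  -- In the limit the bracket multiplying `2 / η` is `2 - 4 + 2 = 0`, leaving `2 * η = ε / 2`.
  set η := ε / 4 with hη_def
  have hη : 0 < η := by positivity
  have hκ : Tendsto (fun j => 2 * η + (2 / η) *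
      (2 - 4 * ((∫ t, Real.sqrt (w t) * poisson t (α (φ j)) ∂m) / Real.sqrt c) +
        ((∫ t, w t * poisson t (α (φ j)) ∂m) + ∫ t, poisson t (α (φ j)) ∂μ) / c)) atTop
      (𝓝 (ε / 2)) := by
    have h := ((((hV.div_const (Real.sqrt c)).const_mul 4).const_sub 2).add
      ((hW.add hM).div_const c)).const_mul (2 / η) |>.const_add (2 * η)
    have e : 2 * η + (2 / η) * (2 - 4 * (Real.sqrt c / Real.sqrt c) + (c + c) / c) = ε / 2 := by
      rw [div_self (Real.sqrt_pos.2 hc).ne', add_div, div_self hc.ne', hη_def]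
      ring
    rwa [e] at h
  filter_upwards [hκ.eventually (gt_mem_nhds (half_lt_self hε)), hφ.eventually_ge_atTop 1]
    with j hj h1
  have h0 : 0 ≤ ∫ t, remainderIntegrand α f (φ j) t ∂m :=
    integral_nonneg fun t => mul_nonneg (by positivity) (poisson_nonneg (hα _) t)
  rw [Real.dist_eq, sub_zero, abs_of_nonneg h0]
  have hle := integral_remainderIntegrand_le hα hf hB hμ hw (φ j - 1) hc hη
  rw [Nat.sub_add_cancel h1] at hle
  exact hle.trans_lt hj

include hlim

/-- By compactness every subsequence has a further one converging to some `ξ` on the circle. The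
hypothesis `h` isolates the Poisson convergence that continuity and nontangential approach each
supply. -/
lemma tendsto_integral_remainderIntegrand
    (hsing : accCircle α ⊆ ((μ.singularPart m).support)ᶜ)
    (h : ∀ ξ ∈ accCircle α, ∀ φ : ℕ → ℕ, StrictMono φ → Tendsto (α ∘ φ) atTop (𝓝 (ξ : ℂ)) →
      0 < w ξ ∧ Tendsto (fun j => ∫ t, |w t - w ξ| * poisson t (α (φ j)) ∂m) atTop (𝓝 0) ∧
      Tendsto (fun j => ∫ t, |Real.sqrt (w t) - Real.sqrt (w ξ)| * poisson t (α (φ j)) ∂m)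
        atTop (𝓝 0)) :
    Tendsto (fun k => ∫ t, remainderIntegrand α f k t ∂m) atTop (𝓝 0) := by
  refine tendsto_of_subseq_tendsto fun ns hns => ?_
  obtain ⟨x, -, ms, hms, hx⟩ := (isCompact_closedBall (0 : ℂ) 1).tendsto_subseq
    (x := fun j => α (ns j)) fun j => by simpa using (hα (ns j)).le
  -- A further thinning makes the indices strictly increasing, as `h` requires.
  obtain ⟨ψ, hψ, hφ⟩ := strictMono_subseq_of_tendsto_atTop (hns.comp hms.tendsto_atTop)
  set φ : ℕ → ℕ := (ns ∘ ms) ∘ ψ with hφ_def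
  have hαφ : Tendsto (α ∘ φ) atTop (𝓝 x) := hx.comp hψ.tendsto_atTop
  have hx1 : ‖x‖ = 1 :=
    tendsto_nhds_unique hαφ.norm (hlim.comp hφ.tendsto_atTop)
  obtain ⟨ξ, rfl⟩ : ∃ ξ : Circle, (ξ : ℂ) = x := ⟨⟨x, mem_sphere_zero_iff_norm.2 hx1⟩, rfl⟩
  have hξ : ξ ∈ accCircle α := by
    refine ⟨mem_closure_of_tendsto hαφ (Eventually.of_forall fun j => ⟨φ j, rfl⟩), ?_⟩
    rintro ⟨k, hk⟩
    have := hα k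
    rw [hk, hx1] at this
    exact lt_irrefl _ this
  obtain ⟨hc, h1, h2⟩ := h ξ hξ φ hφ hαφ
  have hwi := integrable_density hw
  have hW := tendsto_integral_mul_poisson_of_abs hwi (fun j => hα (φ j)) h1
  have hV := tendsto_integral_mul_poisson_of_abs (integrable_sqrt hwi) (fun j => hα (φ j)) h2
  have hM : Tendsto (fun j => ∫ t, poisson t (α (φ j)) ∂μ) atTop (𝓝 (w ξ)) := by
    have h3 := (tendsto_integral_poisson_of_notMem_support (hsing hξ)).comp
      (tendsto_nhdsWithin_iff.2 ⟨hαφ, Eventually.of_forall fun j =>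
        mem_ball_zero_iff.2 (hα (φ j))⟩)
    have h4 := hW.add h3
    rw [add_zero] at h4
    exact h4.congr fun j => (integral_poisson_eq_add hw (hα (φ j))).symm
  exact ⟨ms ∘ ψ, tendsto_integral_remainderIntegrand_comp hα hf hB hμ hw hφ.tendsto_atTop hc
    hV hW hM⟩

end Limit

end MultipointSchur

theorem mainTheorem5
    (α : ℕ → ℂ) (hα : ∀ k, ‖α k‖ < 1)
    (hdiv : ¬ Summable (fun k => 1 - ‖α k‖))
    (hlim : Tendsto (fun k => ‖α k‖) atTop (𝓝 1))
    (f : ℂ → ℂ) (hf : MultipointSchur.IsSchur f) (hB : ¬ MultipointSchur.IsFiniteBlaschke f)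
    (μ : Measure Circle) [IsProbabilityMeasure μ] (hμ : MultipointSchur.IsHerglotzMeasure f μ)
    -- `w` is a version of the density of the absolutely continuous part of `μ`
    (w : Circle → ℝ)
    (hw : w =ᵐ[MultipointSchur.m] fun t => (μ.rnDeriv MultipointSchur.m t).toReal)
    (hsing : MultipointSchur.accCircle α ⊆ ((μ.singularPart MultipointSchur.m).support)ᶜ) :
    ((∃ O : Set Circle, IsOpen O ∧ MultipointSchur.accCircle α ⊆ O ∧
        ContinuousOn w O ∧ ∀ t ∈ O, 0 < w t) →
      (∀ k, Integrable (MultipointSchur.remainderIntegrand α f k) MultipointSchur.m) ∧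
      Tendsto (fun k => ∫ t, MultipointSchur.remainderIntegrand α f k t ∂MultipointSchur.m)
        atTop (𝓝 0)) ∧
    (MultipointSchur.AccumulatesNontangentially α →
      (∀ ξ ∈ MultipointSchur.accCircle α,
        MultipointSchur.IsLebesguePoint w ξ ∧
        MultipointSchur.IsLebesguePoint (fun t => Real.sqrt (w t)) ξ ∧ 0 < w ξ) →
      (∀ k, Integrable (MultipointSchur.remainderIntegrand α f k) MultipointSchur.m) ∧
      Tendsto (fun k => ∫ t, MultipointSchur.remainderIntegrand α f k t ∂MultipointSchur.m)
        atTop (𝓝 0)) := by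
  have hwi := MultipointSchur.integrable_density hw
  have hint := MultipointSchur.integrable_remainderIntegrand hα hf hB
  constructor
  · rintro ⟨O, hO, hAO, hcont, hpos⟩
    refine ⟨hint, MultipointSchur.tendsto_integral_remainderIntegrand hα hlim hf hB hμ hw hsing
      fun ξ hξ φ _ hαφ => ?_⟩
    have hc : ContinuousAt w ξ := hcont.continuousAt (hO.mem_nhds (hAO hξ))
    have hβ := tendsto_nhdsWithin_iff.2 ⟨hαφ, Eventually.of_forall fun j =>
        mem_ball_zero_iff.2 (hα (φ j))⟩
    exact ⟨hpos ξ (hAO hξ),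
      (MultipointSchur.tendsto_integral_mul_poisson_of_continuousAt hwi hc).comp hβ,
      (MultipointSchur.tendsto_integral_mul_poisson_of_continuousAt
        (MultipointSchur.integrable_sqrt hwi) hc.sqrt).comp hβ⟩
  · intro hnt hL
    refine ⟨hint, MultipointSchur.tendsto_integral_remainderIntegrand hα hlim hf hB hμ hw hsing
      fun ξ hξ φ hφ hαφ => ?_⟩
    obtain ⟨h1, h2, hc⟩ := hL ξ hξ
    -- The aperture may depend on the subsequence; the limit is taken along one subsequence at a
    -- time, so this suffices.
    obtain ⟨M, hM⟩ := hnt ξ φ hφ hαφ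
    have hβ := tendsto_nhdsWithin_iff.2 ⟨hαφ, hM⟩
    have hsqrt := MultipointSchur.integrable_sqrt hwi
    exact ⟨hc,
      (MultipointSchur.tendsto_integral_mul_poisson_stolz (fun _ => abs_nonneg _)
        (hwi.sub (integrable_const _)).abs (h1.tendsto_integral_ball_div hwi) M).comp hβ,
      (MultipointSchur.tendsto_integral_mul_poisson_stolz (fun _ => abs_nonneg _)
        (hsqrt.sub (integrable_const _)).abs (h2.tendsto_integral_ball_div hsqrt) M).comp hβ⟩
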